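/- Let $\Theta\subset\mathbb R^k$ be open, let $\mathcal H$ be a measurable space, and for $\theta\in\Theta$, $\eta\in\mathcal H$, $i\ge 1$ let $P_{\theta,\eta,i}$ be a probability measure on a measurable space $\mathcal X_i$ with density $p_{\theta,\eta,i}$ with respect to a $\sigma$-finite measure $\mu_i$, where $(\eta,x)\mapsto p_{\theta,\eta,i}(x)$ is jointly measurable. Write $\ell_{\theta,\eta,i}=\log p_{\theta,\eta,i}\in[-\infty,\infty)$ and let $h(P,Q)=\big(\int(\sqrt{p}-\sqrt{q})^2\,d\mu\big)^{1/2}$ be the Hellinger distance of probability measures with densities $p,q$ with respect to $\mu$. Fix $\theta_0\in\Theta$, $\eta_0\in\mathcal H$, and a prior probability measure $\Pi_{\mathcal H}$ on $\mathcal H$ not depending on $n$. Put $P_0^n=\bigotimes_{i=1}^n P_{\theta_0,\eta_0,i}$. Assume: 1. For all $\eta_1,\eta_2\in\mathcal H$ the number $h(P_{\theta_0,\eta_1,i},P_{\theta_0,\eta_2,i})$ does not depend on $i$; denote it by $d_H(\eta_1,\eta_2)$. 2. $\sup_i\sup_{\eta\in\mathcal H}h(P_{\theta,\eta,i},P_{\theta_0,\eta,i})=O(|\theta-\theta_0|)$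 as $\theta\to\theta_0$. 3. There are a neighbourhood $U\subset\Theta$ of $\theta_0$ and measurable maps $Q_i:\mathcal X_i\to\mathbb R$ with $\sup_i\int Q_i^2\,dP_{\theta_0,\eta_0,i}<\infty$ and $$\sup_{\eta\in\mathcal H}|\ell_{\theta_1,\eta,i}(x)-\ell_{\theta_2,\eta,i}(x)|\le|\theta_1-\theta_2|\,Q_i(x)\qquad\text{for all } i,\ x\in\mathcal X_i,\ \theta_1,\theta_2\in U$$ (where the difference is read as $0$ if both log densities are $-\infty$, and as infinite if exactly one is). 4. For every $\delta>0$ finitely many $d_H$-balls of radius $\delta$ cover $\mathcal H$, i.e. $N(\delta,\mathcal H,d_H)<\infty$. 5. $\Pi_{\mathcal H}(K(\delta))>0$ for every $\delta>0$, where $K(\delta)$ is the set of all $\eta\in\mathcal H$ such that, for every $i$, with expectations taken under $P_{\theta_0,\eta_0,i}$, $$E\Big(-\log\frac{p_{\theta_0,\eta,i}}{p_{\theta_0,\eta_0,i}}\Big)\le\delta^2,\qquad E\Big(\log\frac{p_{\theta_0,\eta,i}}{p_{\theta_0,\eta_0,i}}\Big)^2\le\delta^2 .$$ For each $n$ let $X^{(n)}=(X_1,\dots,X_n)\sim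 P_0^n$, and let $h_n$ be a random vector in $\mathbb R^k$ on the same probability space (it may depend on $X^{(n)}$), such that for some constant $M$ one has $|h_n|\le M$ almost surely for all $n$. Put $\theta_n(h)=\theta_0+h/\sqrt n$, and define the conditional posterior of $\eta$ given $\theta$ by $$\Pi(A\mid\theta,X_1,\dots,X_n)=\frac{\int_A\prod_{i=1}^n p_{\theta,\eta,i}(X_i)\,d\Pi_{\mathcal H}(\eta)}{\int_{\mathcal H}\prod_{i=1}^n p_{\theta,\eta,i}(X_i)\,d\Pi_{\mathcal H}(\eta)} .$$ Then, for all sufficiently large $n$, the denominator at $\theta=\theta_n(h_n)$ is almost surely in $(0,\infty)$, so that this posterior is well defined, and for every $\epsilon>0$ $$\Pi\big(d_H(\eta,\eta_0)>\epsilon\mid\theta=\theta_n(h_n),X_1,\dots,X_n\big)\longrightarrow 0$$ in probability (for a quantity that is not measurable in the sample, in outer probability). -/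

import Mathlib

open MeasureTheory Filter Topology

noncomputable section

/-- A semiparametric model for independent, not necessarily identically distributed observations
`X_0, X_1, …` (the `i`-th one lives in `𝒳 i`).  The finite-dimensional parameter ranges over an open
set `Θ ⊆ ℝ^k`, the nuisance parameter over `H`, and `p θ η i` is the density of the law
of the `i`-th observation with respect to the σ-finite measure `μ i`.  The values `p θ η i` for
`θ ∉ Θ` are irrelevant. -/
structure IndepModel (k : ℕ) (H : Type*) [MeasurableSpace H]
    (𝒳 : ℕ → Type*) [∀ i, MeasurableSpace (𝒳 i)] where
  Θ : Set (EuclideanSpace ℝ (Fin k))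
  isOpen_Θ : IsOpen Θ
  μ : (i : ℕ) → Measure (𝒳 i)
  sigmaFinite_μ : ∀ i, SigmaFinite (μ i)
  p : EuclideanSpace ℝ (Fin k) → H → (i : ℕ) → 𝒳 i → ℝ
  p_nonneg : ∀ θ ∈ Θ, ∀ η i x, 0 ≤ p θ η i x
  measurable_p : ∀ θ ∈ Θ, ∀ i, Measurable (fun z : H × 𝒳 i => p θ z.1 i z.2)
  lintegral_p : ∀ θ ∈ Θ, ∀ η i, ∫⁻ x, ENNReal.ofReal (p θ η i x) ∂(μ i) = 1

namespace IndepModel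

/-- The law `P_{θ,η,i}` of the `i`-th observation. -/
def law {k : ℕ} {H : Type*} [MeasurableSpace H] {𝒳 : ℕ → Type*} [∀ i, MeasurableSpace (𝒳 i)]
    (m : IndepModel k H 𝒳) (θ : EuclideanSpace ℝ (Fin k)) (η : H) (i : ℕ) : Measure (𝒳 i) :=
  (m.μ i).withDensity (fun x => ENNReal.ofReal (m.p θ η i x))

/-- The product law `P_{θ,η}^{(n)}` of the first `n` observations. -/
def lawN {k : ℕ} {H : Type*} [MeasurableSpace H] {𝒳 : ℕ → Type*} [∀ i, MeasurableSpace (𝒳 i)]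
    (m : IndepModel k H 𝒳) (θ : EuclideanSpace ℝ (Fin k)) (η : H) (n : ℕ) :
    Measure ((i : Fin n) → 𝒳 i) :=
  Measure.pi (fun i : Fin n => m.law θ η i)

/-- The Hellinger distance `h(P_{θ₁,η₁,i}, P_{θ₂,η₂,i}) = (∫ (√p₁ - √p₂)² dμ_i)^{1/2}`. -/
def hellinger {k : ℕ} {H : Type*} [MeasurableSpace H] {𝒳 : ℕ → Type*}
    [∀ i, MeasurableSpace (𝒳 i)] (m : IndepModel k H 𝒳) (i : ℕ)
    (θ₁ : EuclideanSpace ℝ (Fin k)) (η₁ : H) (θ₂ : EuclideanSpace ℝ (Fin k)) (η₂ : H) : ℝ :=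
  Real.sqrt (∫ x, (Real.sqrt (m.p θ₁ η₁ i x) - Real.sqrt (m.p θ₂ η₂ i x)) ^ 2 ∂(m.μ i))

/-- `h(P_{θ₀,η₁,i}, P_{θ₀,η₂,i})` does not depend on `i`. -/
def HellingerIndexFree {k : ℕ} {H : Type*} [MeasurableSpace H] {𝒳 : ℕ → Type*}
    [∀ i, MeasurableSpace (𝒳 i)] (m : IndepModel k H 𝒳)
    (θ₀ : EuclideanSpace ℝ (Fin k)) : Prop :=
  ∀ (i j : ℕ) (η₁ η₂ : H), m.hellinger i θ₀ η₁ θ₀ η₂ = m.hellinger j θ₀ η₁ θ₀ η₂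

/-- The Hellinger distance `d_H` on the nuisance space (used when it does not depend on the
index of the observation). -/
def dH {k : ℕ} {H : Type*} [MeasurableSpace H] {𝒳 : ℕ → Type*} [∀ i, MeasurableSpace (𝒳 i)]
    (m : IndepModel k H 𝒳) (θ₀ : EuclideanSpace ℝ (Fin k)) (η₁ η₂ : H) : ℝ :=
  m.hellinger 0 θ₀ η₁ θ₀ η₂

/-- `sup_i sup_η h(P_{θ,η,i}, P_{θ₀,η,i}) = O(|θ - θ₀|)` as `θ → θ₀`. -/
def HellingerLipschitz {k : ℕ} {H : Type*} [MeasurableSpace H] {𝒳 : ℕ → Type*}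
    [∀ i, MeasurableSpace (𝒳 i)] (m : IndepModel k H 𝒳)
    (θ₀ : EuclideanSpace ℝ (Fin k)) : Prop :=
  ∃ C : ℝ, ∀ᶠ θ in 𝓝 θ₀, ∀ (i : ℕ) (η : H), m.hellinger i θ η θ₀ η ≤ C * ‖θ - θ₀‖

/-- There are a neighbourhood `U` of `θ₀` in `Θ` and maps `Q i` with
`sup_i ∫ Q_i² dP_{θ₀,η₀,i} < ∞` and
`sup_η |log p_{θ₁,η,i}(x) - log p_{θ₂,η,i}(x)| ≤ |θ₁ - θ₂| Q_i(x)` for `θ₁, θ₂ ∈ U`.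
A log density may be `-∞`; the difference of two log densities counts as `0` if both
are `-∞`, and as infinite if exactly one is.  Hence the clause on the zeros of the densities. -/
def LogLikLipschitz {k : ℕ} {H : Type*} [MeasurableSpace H] {𝒳 : ℕ → Type*}
    [∀ i, MeasurableSpace (𝒳 i)] (m : IndepModel k H 𝒳)
    (θ₀ : EuclideanSpace ℝ (Fin k)) (η₀ : H) : Prop :=
  ∃ U ∈ 𝓝 θ₀, U ⊆ m.Θ ∧ ∃ Q : (i : ℕ) → 𝒳 i → ℝ,
    (∀ i, Measurable (Q i)) ∧
    (⨆ i, ∫⁻ x, ENNReal.ofReal (Q i x ^ 2) ∂(m.law θ₀ η₀ i)) < ⊤ ∧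
    ∀ (i : ℕ), ∀ θ₁ ∈ U, ∀ θ₂ ∈ U, ∀ (x : 𝒳 i) (η : H),
      (m.p θ₁ η i x = 0 ↔ m.p θ₂ η i x = 0) ∧
      |Real.log (m.p θ₁ η i x) - Real.log (m.p θ₂ η i x)| ≤ ‖θ₁ - θ₂‖ * Q i x

/-- The Kullback–Leibler type neighbourhood `K(ε)` of `η₀`: all `η` such that, for every `i`,
`P₀(-log (p_{θ₀,η,i}/p_{θ₀,η₀,i})) ≤ ε²` and `P₀(log (p_{θ₀,η,i}/p_{θ₀,η₀,i}))² ≤ ε²`.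
The first two clauses say that the second moment is finite as an extended real number
(the log ratio is `-∞` where `p_{θ₀,η,i} = 0 < p_{θ₀,η₀,i}`). -/
def KLNhd {k : ℕ} {H : Type*} [MeasurableSpace H] {𝒳 : ℕ → Type*} [∀ i, MeasurableSpace (𝒳 i)]
    (m : IndepModel k H 𝒳) (θ₀ : EuclideanSpace ℝ (Fin k)) (η₀ : H) (ε : ℝ) : Set H :=
  {η | ∀ i : ℕ,
    (∀ᵐ x ∂(m.law θ₀ η₀ i), 0 < m.p θ₀ η i x) ∧
    MemLp (fun x => Real.log (m.p θ₀ η i x / m.p θ₀ η₀ i x)) 2 (m.law θ₀ η₀ i) ∧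
    ∫ x, -Real.log (m.p θ₀ η i x / m.p θ₀ η₀ i x) ∂(m.law θ₀ η₀ i) ≤ ε ^ 2 ∧
    ∫ x, Real.log (m.p θ₀ η i x / m.p θ₀ η₀ i x) ^ 2 ∂(m.law θ₀ η₀ i) ≤ ε ^ 2}

/-- The likelihood `∏_{i<n} p_{θ,η,i}(x_i)`. -/
def likelihood {k : ℕ} {H : Type*} [MeasurableSpace H] {𝒳 : ℕ → Type*}
    [∀ i, MeasurableSpace (𝒳 i)] (m : IndepModel k H 𝒳) {n : ℕ}
    (θ : EuclideanSpace ℝ (Fin k)) (η : H) (x : (i : Fin n) → 𝒳 i) : ENNReal :=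
  ∏ i : Fin n, ENNReal.ofReal (m.p θ η i (x i))

/-- The likelihood of `θ` integrated over the prior of `η`. -/
def integratedLikelihood {k : ℕ} {H : Type*} [MeasurableSpace H] {𝒳 : ℕ → Type*}
    [∀ i, MeasurableSpace (𝒳 i)] (m : IndepModel k H 𝒳) (prior : Measure H) {n : ℕ}
    (θ : EuclideanSpace ℝ (Fin k)) (x : (i : Fin n) → 𝒳 i) : ENNReal :=
  ∫⁻ η, m.likelihood θ η x ∂prior

/-- The conditional posterior probability `Π(A | θ, x_0, …, x_{n-1})` of a set `A` of nuisance
parameters, by Bayes' formula; meaningful if the integrated likelihood is in `(0, ∞)`. -/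
def condPosterior {k : ℕ} {H : Type*} [MeasurableSpace H] {𝒳 : ℕ → Type*}
    [∀ i, MeasurableSpace (𝒳 i)] (m : IndepModel k H 𝒳) (prior : Measure H) {n : ℕ}
    (θ : EuclideanSpace ℝ (Fin k)) (x : (i : Fin n) → 𝒳 i) (A : Set H) : ENNReal :=
  (∫⁻ η in A, m.likelihood θ η x ∂prior) / m.integratedLikelihood prior θ x

end IndepModel

/-- The covering number `N(δ, H, d)`: the least number of balls `{η | d c η < δ}` that
cover `H` (`⊤` if no finite number does). -/
def coveringNumberOf {H : Type*} (d : H → H → ℝ) (δ : ℝ) : ℕ∞ :=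
  ⨅ (S : Set H) (_ : ∀ η, ∃ c ∈ S, d c η < δ), S.encard

/-- The local parameter `θ_n(h) = θ₀ + h/√n`. -/
def localParam {k : ℕ} (θ₀ : EuclideanSpace ℝ (Fin k)) (n : ℕ)
    (h : EuclideanSpace ℝ (Fin k)) : EuclideanSpace ℝ (Fin k) :=
  θ₀ + (Real.sqrt n)⁻¹ • h

end

/-! Passing from `θ₀` to `θ_n(h_n)` changes every likelihood, uniformly in `η`, by a factor at most
`exp (M / √n * ∑ |Q i|)` in either direction. The sum is of order `n` in probability, so the factor
is below `exp (lam * n / 4)` for any fixed `lam > 0`, outside an event of vanishing probability.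
Uniformity in `θ` makes the dependence of `h_n` on the data harmless. It remains to prove
exponential posterior concentration at `θ₀`, written with likelihood ratios against `(θ₀, η₀)`.

Denominator: for `η` in a Kullback–Leibler neighbourhood Chebyshev bounds the log ratio from below,
and `measure_lintegral_lt_le` transfers this to the mixture, giving at least `κ * exp (-(lam * n /
2))`.

Numerator: no tests are built. The far set is covered by finitely many small Hellinger balls, their
number independent of `n`. For each piece the expected square root of the mixture of likelihood
ratios is at most `ρ ^ n` with `ρ < 1`. By convexity of the squared Hellinger distance, any mixture
of densities from the ball stays near the centre, hence away from the truth, so its affinity to the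
truth is at most `ρ` (`affinity_mixture_le`). Integrating out one observation only reweights the
mixing measure inside the ball, so the bound multiplies (`lintegral_pi_rpow_mixture_prod_le`). A
ball serves all coordinates at once because `d_H` is the same for every index. -/

noncomputable section

/-! ### Hellinger distance and affinity of mixtures -/

/-- The square of the `L²` distance between the roots of two densities. -/
def hellingerSq {𝒴 : Type*} [MeasurableSpace 𝒴] (μ : Measure 𝒴) (p q : 𝒴 → ℝ) : ENNReal :=
  ∫⁻ x, ENNReal.ofReal ((√(p x) - √(q x)) ^ 2) ∂μ

lemma hellingerSq_le_two_mul_add {𝒴 : Type*} [MeasurableSpace 𝒴] (μ : Measure 𝒴) {p q r : 𝒴 → ℝ}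
    (hp : Measurable p) (hq : Measurable q) :
    hellingerSq μ p r ≤ 2 * hellingerSq μ p q + 2 * hellingerSq μ q r := by
  unfold hellingerSq
  rw [← lintegral_const_mul _ (by fun_prop), ← lintegral_const_mul' _ _ (by simp),
    ← lintegral_add_left (by fun_prop)]
  refine lintegral_mono fun x => ?_
  have h2 : (2 : ENNReal) = ENNReal.ofReal 2 := by simp
  rw [h2, ← ENNReal.ofReal_mul (by norm_num), ← ENNReal.ofReal_mul (by norm_num),
    ← ENNReal.ofReal_add (by positivity) (by positivity)]
  refine ENNReal.ofReal_le_ofReal ?_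
  nlinarith [sq_nonneg ((√(p x) - √(q x)) - (√(q x) - √(r x)))]

lemma hellingerSq_comm {𝒴 : Type*} [MeasurableSpace 𝒴] (μ : Measure 𝒴) (p q : 𝒴 → ℝ) :
    hellingerSq μ p q = hellingerSq μ q p := by
  unfold hellingerSq
  congr! 3 with x
  ring

/-- Expand the square. For probability densities the right side is 2, so distance bounded below
means affinity bounded away from 1, and the squared distance is finite. -/
lemma two_mul_affinity_add_hellingerSq {𝒴 : Type*} [MeasurableSpace 𝒴] (μ : Measure 𝒴)
    {p q : 𝒴 → ℝ} (hp : Measurable p) (hq : Measurable q) (hp0 : ∀ x, 0 ≤ p x)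
    (hq0 : ∀ x, 0 ≤ q x) :
    2 * ∫⁻ x, ENNReal.ofReal (√(p x) * √(q x)) ∂μ + hellingerSq μ p q
      = ∫⁻ x, ENNReal.ofReal (p x) ∂μ + ∫⁻ x, ENNReal.ofReal (q x) ∂μ := by
  unfold hellingerSq
  rw [← lintegral_const_mul _ (by fun_prop), ← lintegral_add_left (by fun_prop),
    ← lintegral_add_left (by fun_prop)]
  refine lintegral_congr fun x => ?_
  have h2 : (2 : ENNReal) = ENNReal.ofReal 2 := by simp
  rw [h2, ← ENNReal.ofReal_mul (by norm_num),
    ← ENNReal.ofReal_add (by positivity) (by positivity), ← ENNReal.ofReal_add (hp0 x) (hq0 x)]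
  congr 1
  nlinarith [Real.sq_sqrt (hp0 x), Real.sq_sqrt (hq0 x)]

/-- Convexity of the squared Hellinger distance, pointwise. -/
lemma ofReal_sqrt_sub_sqrt_lintegral_sq_le {H : Type*} [MeasurableSpace H] (π : Measure H)
    [IsProbabilityMeasure π] {f : H → ℝ} (hf : Measurable f) (hf0 : ∀ η, 0 ≤ f η)
    (hfin : ∫⁻ η, ENNReal.ofReal (f η) ∂π < ⊤) {a : ℝ} (ha : 0 ≤ a) :
    ENNReal.ofReal ((√a - √(∫⁻ η, ENNReal.ofReal (f η) ∂π).toReal) ^ 2)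
      ≤ ∫⁻ η, ENNReal.ofReal ((√a - √(f η)) ^ 2) ∂π := by
  have hint : Integrable f π := by
    refine ⟨hf.aestronglyMeasurable, ?_⟩
    rw [hasFiniteIntegral_iff_ofReal (Eventually.of_forall hf0)]
    exact hfin
  have hF : (∫⁻ η, ENNReal.ofReal (f η) ∂π).toReal = ∫ η, f η ∂π :=
    (integral_eq_lintegral_of_nonneg_ae (Eventually.of_forall hf0) hf.aestronglyMeasurable).symm
  have hL2 : MemLp (fun η => √(f η)) 2 π := by
    rw [memLp_two_iff_integrable_sq (by fun_prop)]
    simpa [Real.sq_sqrt (hf0 _)] using hint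
  have hs : Integrable (fun η => √(f η)) π := hL2.integrable (by norm_num)
  -- Jensen for the square root, as nonnegativity of the variance of `√f`. After expansion the two
  -- sides of the goal differ only in the cross term, which this controls.
  have hJ : (∫ η, √(f η) ∂π) ^ 2 ≤ ∫ η, f η ∂π := by
    have := ProbabilityTheory.variance_eq_sub hL2
    have h0 := ProbabilityTheory.variance_nonneg (fun η => √(f η)) π
    have : ∫ η, ((fun η => √(f η)) ^ 2) η ∂π = ∫ η, f η ∂π := by
      simp [Real.sq_sqrt (hf0 _)]
    linarith
  have hexp : ∀ η, (√a - √(f η)) ^ 2 = (a - 2 * √a * √(f η)) + f η := fun η => by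
    nlinarith [Real.sq_sqrt ha, Real.sq_sqrt (hf0 η)]
  have hi : Integrable (fun η => (√a - √(f η)) ^ 2) π := by
    simp_rw [hexp]
    exact ((integrable_const a).sub (hs.const_mul _)).add hint
  rw [hF, ← ofReal_integral_eq_lintegral_ofReal hi (Eventually.of_forall fun η => sq_nonneg _)]
  refine ENNReal.ofReal_le_ofReal ?_
  simp_rw [hexp]
  have h1 : Integrable (fun η => a - 2 * √a * √(f η)) π :=
    (integrable_const a).sub (hs.const_mul _)
  rw [integral_add h1 hint, integral_sub (integrable_const a) (hs.const_mul _),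
    integral_const_mul]
  have hI0 : 0 ≤ ∫ η, f η ∂π := integral_nonneg hf0
  have hle : ∫ η, √(f η) ∂π ≤ √(∫ η, f η ∂π) := Real.le_sqrt_of_sq_le hJ
  simp only [integral_const, probReal_univ, smul_eq_mul, one_mul]
  nlinarith [Real.sq_sqrt ha, Real.sq_sqrt hI0, mul_le_mul_of_nonneg_left hle (Real.sqrt_nonneg a)]

/-- A mixture of densities that are close to `q` has affinity to `p` bounded away from `1`
if `q` is far from `p`. -/
lemma affinity_mixture_le {H 𝒴 : Type*} [MeasurableSpace H] [MeasurableSpace 𝒴]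
    (μ : Measure 𝒴) [SFinite μ] (π : Measure H) [IsProbabilityMeasure π] {p q : 𝒴 → ℝ}
    {r : H → 𝒴 → ℝ} (hp : Measurable p) (hq : Measurable q)
    (hr : Measurable (Function.uncurry r)) (hp0 : ∀ x, 0 ≤ p x) (hq0 : ∀ x, 0 ≤ q x)
    (hr0 : ∀ η x, 0 ≤ r η x) (hp1 : ∫⁻ x, ENNReal.ofReal (p x) ∂μ = 1)
    (hr1 : ∀ η, ∫⁻ x, ENNReal.ofReal (r η x) ∂μ = 1) {a b ρ : ℝ} (ha : 0 ≤ a)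
    (hclose : ∀ᵐ η ∂π, hellingerSq μ q (r η) ≤ ENNReal.ofReal a)
    (hfar : ENNReal.ofReal b ≤ hellingerSq μ p q) (hρ : 1 - (b / 2 - a) / 2 ≤ ρ) :
    ∫⁻ x, ENNReal.ofReal √(p x) * (∫⁻ η, ENNReal.ofReal (r η x) ∂π) ^ (1 / 2 : ℝ) ∂μ
      ≤ ENNReal.ofReal ρ := by
  have hr' : Measurable (Function.uncurry fun η x => ENNReal.ofReal (r η x)) := by
    exact ENNReal.measurable_ofReal.comp hr
  set G : 𝒴 → ENNReal := fun x => ∫⁻ η, ENNReal.ofReal (r η x) ∂π with hG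
  have hGm : Measurable G := Measurable.lintegral_prod_left' hr'
  have hG1 : ∫⁻ x, G x ∂μ = 1 := by
    rw [hG, lintegral_lintegral_swap (f := fun x η => ENNReal.ofReal (r η x))
      (hr'.comp measurable_swap).aemeasurable]
    simp [hr1]
  -- The mixture density may be infinite on a null set only, so its real version `g` is still a
  -- probability density.
  have hGfin : ∀ᵐ x ∂μ, G x < ⊤ := ae_lt_top hGm (by simp [hG1])
  set g : 𝒴 → ℝ := fun x => (G x).toReal with hg
  have hgm : Measurable g := hGm.ennreal_toReal
  have hg0 : ∀ x, 0 ≤ g x := fun x => ENNReal.toReal_nonneg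
  have hg1 : ∫⁻ x, ENNReal.ofReal (g x) ∂μ = 1 := by
    rw [← hG1]
    refine lintegral_congr_ae ?_
    filter_upwards [hGfin] with x hx using ENNReal.ofReal_toReal hx.ne
  have hqg : hellingerSq μ q g ≤ ENNReal.ofReal a := by
    calc hellingerSq μ q g
        ≤ ∫⁻ x, ∫⁻ η, ENNReal.ofReal ((√(q x) - √(r η x)) ^ 2) ∂π ∂μ := by
          refine lintegral_mono_ae ?_
          filter_upwards [hGfin] with x hx
          exact ofReal_sqrt_sub_sqrt_lintegral_sq_le π (hr.of_uncurry_right) (fun η => hr0 η x) hx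
            (hq0 x)
      _ = ∫⁻ η, hellingerSq μ q (r η) ∂π := by
          rw [lintegral_lintegral_swap]
          · rfl
          · have := hr.comp (measurable_swap (α := 𝒴) (β := H))
            have h2 : Measurable fun z : 𝒴 × H => r z.2 z.1 := this
            exact Measurable.aemeasurable (by unfold Function.uncurry; fun_prop)
      _ ≤ ∫⁻ η, ENNReal.ofReal a ∂π := lintegral_mono_ae hclose
      _ = ENNReal.ofReal a := by simp
  -- From `b ≤ h²(p,q) ≤ 2 h²(p,g) + 2 h²(g,q)` and `h²(q,g) ≤ a`.
  have hpg : ENNReal.ofReal (b / 2 - a) ≤ hellingerSq μ p g := by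
    have h1 := hfar.trans (hellingerSq_le_two_mul_add μ hp hgm (r := q))
    rw [hellingerSq_comm μ g q] at h1
    have h3 : hellingerSq μ p g ≤ 2 := by
      have := two_mul_affinity_add_hellingerSq μ hp hgm hp0 hg0
      rw [hp1, hg1, one_add_one_eq_two] at this
      exact le_of_add_le_right this.le
    have h4 : hellingerSq μ p g ≠ ⊤ := ne_top_of_le_ne_top (by simp) h3
    have h5 : ENNReal.ofReal b ≤ ENNReal.ofReal (2 * (hellingerSq μ p g).toReal + 2 * a) := by
      refine h1.trans ?_
      rw [ENNReal.ofReal_add (by positivity) (by positivity),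
        ENNReal.ofReal_mul (by norm_num), ENNReal.ofReal_mul (by norm_num),
        ENNReal.ofReal_toReal h4]
      simp only [ENNReal.ofReal_ofNat]
      gcongr
    have h6 := (ENNReal.ofReal_le_ofReal_iff (by positivity)).1 h5
    rw [← ENNReal.ofReal_toReal h4]
    exact ENNReal.ofReal_le_ofReal (by linarith)
  have hid := two_mul_affinity_add_hellingerSq μ hp hgm hp0 hg0
  rw [hp1, hg1, one_add_one_eq_two] at hid
  have haff : ∫⁻ x, ENNReal.ofReal √(p x) * G x ^ (1 / 2 : ℝ) ∂μ
      = ∫⁻ x, ENNReal.ofReal (√(p x) * √(g x)) ∂μ := by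
    refine lintegral_congr_ae ?_
    filter_upwards [hGfin] with x hx
    rw [ENNReal.ofReal_mul (Real.sqrt_nonneg _), Real.sqrt_eq_rpow (g x),
      ← ENNReal.ofReal_rpow_of_nonneg (hg0 x) (by norm_num), ENNReal.ofReal_toReal hx.ne]
  rw [haff]
  set A := ∫⁻ x, ENNReal.ofReal (√(p x) * √(g x)) ∂μ
  have hAfin : A ≠ ⊤ := by
    rintro h
    simp [h] at hid
  have h7 : ENNReal.ofReal (2 * A.toReal + (b / 2 - a)) ≤ ENNReal.ofReal 2 := by
    refine ENNReal.ofReal_add_le.trans ?_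
    rw [ENNReal.ofReal_mul (by norm_num), ENNReal.ofReal_toReal hAfin]
    simp only [ENNReal.ofReal_ofNat]
    exact (add_le_add_right hpg (2 * A)).trans hid.le
  have h8 := (ENNReal.ofReal_le_ofReal_iff (by positivity)).1 h7
  rw [← ENNReal.ofReal_toReal hAfin]
  exact ENNReal.ofReal_le_ofReal (by linarith)

/-- The one-observation bound for the root of a mixture of likelihood ratios. -/
lemma lintegral_sqrt_mixture_ratio_le {H 𝒴 : Type*} [MeasurableSpace H] [MeasurableSpace 𝒴]
    (μ : Measure 𝒴) [SFinite μ] (ν : Measure H) {p q : 𝒴 → ℝ}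
    {r : H → 𝒴 → ℝ} (hp : Measurable p) (hq : Measurable q)
    (hr : Measurable (Function.uncurry r)) (hp0 : ∀ x, 0 ≤ p x) (hq0 : ∀ x, 0 ≤ q x)
    (hr0 : ∀ η x, 0 ≤ r η x) (hp1 : ∫⁻ x, ENNReal.ofReal (p x) ∂μ = 1)
    (hr1 : ∀ η, ∫⁻ x, ENNReal.ofReal (r η x) ∂μ = 1) {a b ρ : ℝ} (ha : 0 ≤ a)
    (hclose : ∀ᵐ η ∂ν, hellingerSq μ q (r η) ≤ ENNReal.ofReal a)
    (hfar : ENNReal.ofReal b ≤ hellingerSq μ p q) (hρ : 1 - (b / 2 - a) / 2 ≤ ρ) (hρ0 : 0 < ρ) :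
    ∫⁻ x, (∫⁻ η, ENNReal.ofReal (r η x) / ENNReal.ofReal (p x) ∂ν) ^ (1 / 2 : ℝ)
        ∂(μ.withDensity fun x => ENNReal.ofReal (p x))
      ≤ ENNReal.ofReal ρ * ν Set.univ ^ (1 / 2 : ℝ) := by
  -- The mixing measure is to be normalised, so total mass `0` and `⊤` are split off; in the
  -- infinite case `0 < ρ` makes the right side infinite.
  rcases eq_or_ne (ν Set.univ) 0 with h0 | h0
  · have : ν = 0 := Measure.measure_univ_eq_zero.1 h0
    simp [this]
  rcases eq_or_ne (ν Set.univ) ⊤ with ht | ht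
  · rw [ht, ENNReal.top_rpow_of_pos (by norm_num),
      ENNReal.mul_top (by simpa using hρ0)]
    exact le_top
  set t := ν Set.univ with htdef
  have hπ : IsProbabilityMeasure (t⁻¹ • ν) :=
    ⟨by rw [Measure.smul_apply, smul_eq_mul]; exact ENNReal.inv_mul_cancel h0 ht⟩
  have hνπ : ν = t • (t⁻¹ • ν) := by
    rw [smul_smul, ENNReal.mul_inv_cancel h0 ht, one_smul]
  have hclose' : ∀ᵐ η ∂(t⁻¹ • ν), hellingerSq μ q (r η) ≤ ENNReal.ofReal a :=
    Measure.ae_smul_measure hclose _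
  have key := affinity_mixture_le μ (t⁻¹ • ν) hp hq hr hp0 hq0 hr0 hp1 hr1 ha hclose' hfar hρ
  calc _ ≤ ∫⁻ x, ENNReal.ofReal (p x) *
        (∫⁻ η, ENNReal.ofReal (r η x) / ENNReal.ofReal (p x) ∂ν) ^ (1 / 2 : ℝ) ∂μ :=
        lintegral_withDensity_le_lintegral_mul _ (by fun_prop) _
    _ ≤ ∫⁻ x, t ^ (1 / 2 : ℝ) * (ENNReal.ofReal √(p x) *
          (∫⁻ η, ENNReal.ofReal (r η x) ∂(t⁻¹ • ν)) ^ (1 / 2 : ℝ)) ∂μ := by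
        refine lintegral_mono fun x => ?_
        -- Where `p x = 0` the ratio may be infinite, but its weight `p x` is zero. Elsewhere `p *
        -- p⁻¹ ^ (1/2) = p ^ (1/2)` turns the root of the ratio into an affinity integrand.
        rcases (hp0 x).eq_or_lt with hx | hx
        · simp [← hx]
        have hx' : ENNReal.ofReal (p x) ≠ 0 := by simpa using hx
        have e1 : ∫⁻ η, ENNReal.ofReal (r η x) / ENNReal.ofReal (p x) ∂ν
            = t * (∫⁻ η, ENNReal.ofReal (r η x) ∂(t⁻¹ • ν)) * (ENNReal.ofReal (p x))⁻¹ := by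
          simp_rw [div_eq_mul_inv]
          rw [lintegral_mul_const' _ _ (ENNReal.inv_ne_top.2 hx')]
          congr 1
          conv_lhs => rw [hνπ]
          rw [lintegral_smul_measure, smul_eq_mul]
        rw [e1, ENNReal.mul_rpow_of_nonneg _ _ (by norm_num),
          ENNReal.mul_rpow_of_nonneg _ _ (by norm_num), Real.sqrt_eq_rpow,
          ← ENNReal.ofReal_rpow_of_nonneg hx.le (by norm_num)]
        set y := ENNReal.ofReal (p x)
        set z := (∫⁻ η, ENNReal.ofReal (r η x) ∂(t⁻¹ • ν)) ^ (1 / 2 : ℝ)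
        have hy : y * y⁻¹ ^ (1 / 2 : ℝ) = y ^ (1 / 2 : ℝ) := by
          rw [ENNReal.inv_rpow, ← ENNReal.rpow_neg]
          nth_rw 1 [← ENNReal.rpow_one y]
          rw [← ENNReal.rpow_add _ _ hx' ENNReal.ofReal_ne_top]
          norm_num
        rw [← hy]
        exact le_of_eq (by ring)
    _ = t ^ (1 / 2 : ℝ) * ∫⁻ x, ENNReal.ofReal √(p x) *
          (∫⁻ η, ENNReal.ofReal (r η x) ∂(t⁻¹ • ν)) ^ (1 / 2 : ℝ) ∂μ :=
        lintegral_const_mul' _ _ (by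
          exact ENNReal.rpow_ne_top_of_nonneg (by norm_num) ht)
    _ ≤ t ^ (1 / 2 : ℝ) * ENNReal.ofReal ρ := by gcongr
    _ = _ := mul_comm _ _

/-! ### Tensorization over independent coordinates -/

/-- A moment bound for mixtures with respect to one coordinate carries over to products. -/
lemma lintegral_pi_rpow_mixture_prod_le {H : Type*} [MeasurableSpace H] (ν₀ : Measure H) (s : ℝ)
    (ρ : ENNReal) (n : ℕ) :
    ∀ {𝒴 : Fin n → Type*} [∀ i, MeasurableSpace (𝒴 i)] (P : ∀ i, Measure (𝒴 i))
      [∀ i, SigmaFinite (P i)] (r : ∀ i, H → 𝒴 i → ENNReal)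
      (_ : ∀ i, Measurable (Function.uncurry (r i)))
      (_ : ∀ i, ∀ (ν : Measure H) [SFinite ν], ν ≪ ν₀ →
        ∫⁻ x, (∫⁻ η, r i η x ∂ν) ^ s ∂(P i) ≤ ρ * ν Set.univ ^ s)
      (ν : Measure H) [SFinite ν] (_ : ν ≪ ν₀),
      ∫⁻ x, (∫⁻ η, ∏ i, r i η (x i) ∂ν) ^ s ∂(Measure.pi P) ≤ ρ ^ n * ν Set.univ ^ s := by
  induction n with
  | zero =>
    intro 𝒴 _ P _ r hr hstep ν _ hν
    simp
  | succ n ih =>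
    intro 𝒴 _ P _ r hr hstep ν _ hν
    have hm : Measurable fun z : 𝒴 0 × ((j : Fin n) → 𝒴 ((0 : Fin (n + 1)).succAbove j)) =>
        (∫⁻ η, r 0 η z.1 * ∏ j : Fin n, r ((0 : Fin (n + 1)).succAbove j) η (z.2 j) ∂ν) ^ s := by
      refine Measurable.pow_const ?_ s
      refine Measurable.lintegral_prod_right' (ν := ν) (f := fun w :
        (𝒴 0 × ((j : Fin n) → 𝒴 ((0 : Fin (n + 1)).succAbove j))) × H =>
          r 0 w.2 w.1.1 * ∏ j : Fin n, r ((0 : Fin (n + 1)).succAbove j) w.2 (w.1.2 j)) ?_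
      refine Measurable.mul ?_ (Finset.measurable_prod _ fun j _ => ?_)
      · exact (hr 0).comp (f := fun w :
          (𝒴 0 × ((j : Fin n) → 𝒴 ((0 : Fin (n + 1)).succAbove j))) × H => (w.2, w.1.1))
          (by fun_prop)
      · exact (hr ((0 : Fin (n + 1)).succAbove j)).comp (f := fun w :
          (𝒴 0 × ((j : Fin n) → 𝒴 ((0 : Fin (n + 1)).succAbove j))) × H => (w.2, w.1.2 j))
          (by fun_prop)
    have hmp := measurePreserving_piFinSuccAbove P 0
    calc ∫⁻ x, (∫⁻ η, ∏ i, r i η (x i) ∂ν) ^ s ∂(Measure.pi P)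
        = ∫⁻ z, (∫⁻ η, r 0 η z.1 *
            ∏ j : Fin n, r ((0 : Fin (n + 1)).succAbove j) η (z.2 j) ∂ν) ^ s
            ∂((P 0).prod (Measure.pi fun j => P ((0 : Fin (n + 1)).succAbove j))) := by
          rw [← hmp.lintegral_comp hm]
          refine lintegral_congr fun x => ?_
          simp_rw [Fin.prod_univ_succAbove _ 0]
          rfl
      _ = ∫⁻ y, ∫⁻ z, (∫⁻ η, r 0 η y *
            ∏ j : Fin n, r ((0 : Fin (n + 1)).succAbove j) η (z j) ∂ν) ^ s
            ∂(Measure.pi fun j => P ((0 : Fin (n + 1)).succAbove j)) ∂(P 0) :=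
          lintegral_prod _ hm.aemeasurable
      _ ≤ ∫⁻ y, ρ ^ n * (∫⁻ η, r 0 η y ∂ν) ^ s ∂(P 0) := by
          refine lintegral_mono fun y => ?_
          have hry : Measurable fun η => r 0 η y := (hr 0).of_uncurry_right
          -- With the first observation fixed at `y`, the other factors are mixed by `ν` reweighted
          -- with `r 0 · y`. This measure is still `≪ ν₀`, which is why the one-coordinate
          -- hypothesis ranges over all such measures.
          have := ih (fun j => P ((0 : Fin (n + 1)).succAbove j))
            (fun j => r ((0 : Fin (n + 1)).succAbove j)) (fun j => hr _)
            (fun j ν' _ h' => hstep _ ν' h') (ν.withDensity fun η => r 0 η y)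
            ((withDensity_absolutelyContinuous _ _).trans hν)
          rw [withDensity_apply _ MeasurableSet.univ, Measure.restrict_univ] at this
          refine le_trans (le_of_eq ?_) this
          refine lintegral_congr fun z => ?_
          rw [lintegral_withDensity_eq_lintegral_mul _ hry]
          · rfl
          · exact Finset.measurable_prod _ fun j _ => (hr _).of_uncurry_right
      _ = ρ ^ n * ∫⁻ y, (∫⁻ η, r 0 η y ∂ν) ^ s ∂(P 0) := by
          refine lintegral_const_mul _ ?_
          refine Measurable.pow_const ?_ s
          exact Measurable.lintegral_prod_left' (hr 0)
      _ ≤ ρ ^ n * (ρ * ν Set.univ ^ s) := by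
          gcongr
          exact hstep 0 ν hν
      _ = ρ ^ (n + 1) * ν Set.univ ^ s := by ring

/-! ### Lower bounds for mixtures, and finite covers -/

/-- If each `F η` with `η ∈ K` is rarely small, then the mixture of the `F η` is rarely small.
The set `K` need not be measurable. -/
lemma measure_lintegral_lt_le {H 𝒴 : Type*} [MeasurableSpace H] [MeasurableSpace 𝒴]
    (ν : Measure 𝒴) [IsProbabilityMeasure ν] (π : Measure H) [IsProbabilityMeasure π]
    {F : H → 𝒴 → ENNReal} (hF : Measurable (Function.uncurry F)) {K : Set H} (hK : 0 < π K)
    {t u : ENNReal} (hu : ∀ η ∈ K, ν {x | F η x < t} ≤ u) :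
    ν {x | ∫⁻ η, F η x ∂π < t * (π K / 2)} ≤ 2 * u := by
  have hS : MeasurableSet {z : H × 𝒴 | F z.1 z.2 < t} := measurableSet_lt hF measurable_const
  set φ : H → ENNReal := fun η => ν {x | F η x < t} with hφ
  have hφm : Measurable φ := measurable_measure_prodMk_left hS
  -- A measurable set containing `K` on which the same bound holds, so Tonelli applies although `K`
  -- may be nonmeasurable.
  set K' : Set H := {η | φ η ≤ u} with hK'
  have hK'm : MeasurableSet K' := measurableSet_le hφm measurable_const
  have hKK' : K ⊆ K' := hu
  have hK'0 : 0 < π K' := hK.trans_le (measure_mono hKK')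
  have hK'fin : π K' ≠ ⊤ := measure_ne_top _ _
  set G : 𝒴 → ENNReal := fun x => (π.restrict K') {η | F η x < t} with hG
  have hGm : Measurable G := measurable_measure_prodMk_right hS
  have hGint : ∫⁻ x, G x ∂ν ≤ u * π K' := by
    calc ∫⁻ x, G x ∂ν = ((π.restrict K').prod ν) {z : H × 𝒴 | F z.1 z.2 < t} :=
          (Measure.prod_apply_symm hS).symm
      _ = ∫⁻ η, φ η ∂(π.restrict K') := Measure.prod_apply hS
      _ ≤ ∫⁻ _ in K', u ∂π := setLIntegral_mono' hK'm fun η hη => hη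
      _ = u * π K' := by simp
  -- `G x` is the mass of those `η ∈ K'` with small `F η x`. Outside this event at least half of
  -- `K'` has `F η x ≥ t`, which accounts for both factors of two.
  have hmarkov : ν {x | π K' / 2 ≤ G x} ≤ 2 * u := by
    have h1 := (mul_meas_ge_le_lintegral hGm (μ := ν) (π K' / 2)).trans hGint
    have h2 : (π K' / 2) * ν {x | π K' / 2 ≤ G x} ≤ (π K' / 2) * (2 * u) := by
      refine h1.trans (le_of_eq ?_)
      rw [← mul_assoc, ENNReal.div_mul_cancel (by simp) (by simp), mul_comm]
    exact (ENNReal.mul_le_mul_iff_right (ENNReal.div_pos hK'0.ne' (by simp)).ne'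
      (ENNReal.div_ne_top hK'fin (by simp))).1 h2
  refine (measure_mono fun x hx => ?_).trans hmarkov
  by_contra hlt
  simp only [Set.mem_ofPred_eq, not_le] at hlt hx
  refine absurd hx (not_lt.2 ?_)
  have hFx : Measurable fun η => F η x := hF.of_uncurry_right
  have hmeas : MeasurableSet {η | F η x < t} := measurableSet_lt hFx measurable_const
  have hbig : π K' / 2 ≤ (π.restrict K') {η | t ≤ F η x} := by
    have hadd := measure_add_measure_compl (μ := π.restrict K') hmeas
    have hc : {η | F η x < t}ᶜ = {η | t ≤ F η x} := by ext; simp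
    rw [hc, Measure.restrict_apply_univ] at hadd
    by_contra hcon
    have := ENNReal.add_lt_add hlt (not_le.1 hcon)
    rw [ENNReal.add_halves] at this
    exact this.ne hadd
  calc t * (π K / 2) ≤ t * (π K' / 2) := by gcongr
    _ ≤ t * (π.restrict K') {η | t ≤ F η x} := by gcongr
    _ ≤ ∫⁻ η in K', F η x ∂π := mul_meas_ge_le_lintegral hFx t
    _ ≤ ∫⁻ η, F η x ∂π := setLIntegral_le_lintegral _ _

/-- If `F η` is almost surely positive for all `η` in a set of positive outer measure, then the
mixture of the `F η` is almost surely positive. -/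
lemma ae_lintegral_pos {H 𝒴 : Type*} [MeasurableSpace H] [MeasurableSpace 𝒴]
    (ν : Measure 𝒴) [SFinite ν] (π : Measure H) [SFinite π]
    {F : H → 𝒴 → ENNReal} (hF : Measurable (Function.uncurry F)) {K : Set H} (hK : 0 < π K)
    (hpos : ∀ η ∈ K, ∀ᵐ x ∂ν, 0 < F η x) : ∀ᵐ x ∂ν, 0 < ∫⁻ η, F η x ∂π := by
  have hS : MeasurableSet {z : H × 𝒴 | F z.1 z.2 = 0} := hF (measurableSet_singleton 0)
  set K' : Set H := {η | ν {x | F η x = 0} = 0} with hK'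
  have hK'm : MeasurableSet K' :=
    (measurable_measure_prodMk_left hS) (measurableSet_singleton (0 : ENNReal))
  have hK'0 : 0 < π K' := hK.trans_le (measure_mono fun η hη => by
    have := hpos η hη
    simpa [hK', ae_iff, pos_iff_ne_zero] using this)
  have h1 : ∀ᵐ η ∂(π.restrict K'), ∀ᵐ x ∂ν, F η x ≠ 0 := by
    refine (ae_restrict_iff' hK'm).2 (Eventually.of_forall fun η hη => ?_)
    have hη' : ν {x | F η x = 0} = 0 := hη
    simpa [ae_iff] using hη'
  have h2 : ∀ᵐ x ∂ν, ∀ᵐ η ∂(π.restrict K'), F η x ≠ 0 :=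
    (Measure.ae_ae_comm hS.compl).1 h1
  filter_upwards [h2] with x hx
  rw [pos_iff_ne_zero]
  intro h0
  have h3 : ∀ᵐ η ∂(π.restrict K'), F η x = 0 :=
    ae_restrict_of_ae ((lintegral_eq_zero_iff hF.of_uncurry_right).1 h0)
  have h4 : ∀ᵐ η ∂(π.restrict K'), False := by
    filter_upwards [hx, h3] with η a b using a b
  rw [ae_iff] at h4
  simp at h4
  exact hK'0.ne' h4

lemma exists_finset_cover_of_coveringNumberOf_lt_top {H : Type*} {d : H → H → ℝ} {δ : ℝ}
    (h : coveringNumberOf d δ < ⊤) : ∃ S : Finset H, ∀ η, ∃ c ∈ S, d c η < δ := by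
  simp only [coveringNumberOf, iInf_lt_iff] at h
  obtain ⟨S, hS, hlt⟩ := h
  have hfin : S.Finite := Set.encard_lt_top_iff.1 hlt
  refine ⟨hfin.toFinset, fun η => ?_⟩
  simpa using hS η

/-! ### Likelihood ratios at `θ₀` -/

namespace IndepModel

variable {k : ℕ} {H : Type*} [MeasurableSpace H] {𝒳 : ℕ → Type*} [∀ i, MeasurableSpace (𝒳 i)]

lemma measurable_p_right (m : IndepModel k H 𝒳) {θ : EuclideanSpace ℝ (Fin k)} (hθ : θ ∈ m.Θ)
    (η : H) (i : ℕ) : Measurable (m.p θ η i) :=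
  (m.measurable_p θ hθ i).comp measurable_prodMk_left

lemma isProbabilityMeasure_law (m : IndepModel k H 𝒳) {θ : EuclideanSpace ℝ (Fin k)}
    (hθ : θ ∈ m.Θ) (η : H) (i : ℕ) : IsProbabilityMeasure (m.law θ η i) :=
  ⟨by rw [law, withDensity_apply _ MeasurableSet.univ, Measure.restrict_univ,
        m.lintegral_p θ hθ η i]⟩

lemma ae_law_pos (m : IndepModel k H 𝒳) {θ : EuclideanSpace ℝ (Fin k)}
    (hθ : θ ∈ m.Θ) (η : H) (i : ℕ) : ∀ᵐ x ∂(m.law θ η i), 0 < m.p θ η i x := by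
  rw [law, ae_withDensity_iff (m.measurable_p_right hθ η i).ennreal_ofReal]
  exact Eventually.of_forall fun x hx => by simpa using hx

/-- The integral is at most 2, hence finite, so the real and the extended versions carry the same
information. -/
lemma ofReal_hellinger_sq (m : IndepModel k H 𝒳) {θ : EuclideanSpace ℝ (Fin k)}
    (hθ : θ ∈ m.Θ) (η₁ η₂ : H) (i : ℕ) :
    ENNReal.ofReal (m.hellinger i θ η₁ θ η₂ ^ 2)
      = hellingerSq (m.μ i) (m.p θ η₁ i) (m.p θ η₂ i) := by
  have h1 := m.measurable_p_right hθ η₁ i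
  have h2 := m.measurable_p_right hθ η₂ i
  have hid := two_mul_affinity_add_hellingerSq (m.μ i) h1 h2
    (m.p_nonneg θ hθ η₁ i) (m.p_nonneg θ hθ η₂ i)
  rw [m.lintegral_p θ hθ, m.lintegral_p θ hθ, one_add_one_eq_two] at hid
  have hfin : hellingerSq (m.μ i) (m.p θ η₁ i) (m.p θ η₂ i) ≠ ⊤ :=
    ne_top_of_le_ne_top (by simp) (le_of_add_le_right hid.le)
  rw [hellinger, Real.sq_sqrt (integral_nonneg fun x => sq_nonneg _),
    integral_eq_lintegral_of_nonneg_ae (Eventually.of_forall fun x => sq_nonneg _)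
      (by fun_prop : Measurable _).aestronglyMeasurable]
  exact ENNReal.ofReal_toReal hfin

/-- The likelihood ratio of one observation. -/
def ratio (m : IndepModel k H 𝒳) (θ₀ : EuclideanSpace ℝ (Fin k)) (η₀ : H) (i : ℕ) (η : H)
    (x : 𝒳 i) : ENNReal :=
  ENNReal.ofReal (m.p θ₀ η i x) / ENNReal.ofReal (m.p θ₀ η₀ i x)

/-- The likelihood ratio of the first `n` observations. -/
def ratioN (m : IndepModel k H 𝒳) (θ₀ : EuclideanSpace ℝ (Fin k)) (η₀ : H) (n : ℕ) (η : H)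
    (x : (i : Fin n) → 𝒳 i) : ENNReal :=
  ∏ i : Fin n, m.ratio θ₀ η₀ i η (x i)

lemma measurable_ratio (m : IndepModel k H 𝒳) {θ₀ : EuclideanSpace ℝ (Fin k)} (hθ₀ : θ₀ ∈ m.Θ)
    (η₀ : H) (i : ℕ) : Measurable (Function.uncurry (m.ratio θ₀ η₀ i)) :=
  (m.measurable_p θ₀ hθ₀ i).ennreal_ofReal.div
    ((m.measurable_p_right hθ₀ η₀ i).ennreal_ofReal.comp measurable_snd)

lemma measurable_ratioN (m : IndepModel k H 𝒳) {θ₀ : EuclideanSpace ℝ (Fin k)} (hθ₀ : θ₀ ∈ m.Θ)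
    (η₀ : H) (n : ℕ) : Measurable (Function.uncurry (m.ratioN θ₀ η₀ n)) := by
  change Measurable fun z : H × ((i : Fin n) → 𝒳 i) => ∏ i : Fin n, m.ratio θ₀ η₀ i z.1 (z.2 i)
  refine Finset.measurable_prod _ fun i _ => ?_
  exact (m.measurable_ratio hθ₀ η₀ i).comp
    (f := fun z : H × ((i : Fin n) → 𝒳 i) => (z.1, z.2 i)) (by fun_prop)

lemma isProbabilityMeasure_lawN (m : IndepModel k H 𝒳) {θ : EuclideanSpace ℝ (Fin k)}
    (hθ : θ ∈ m.Θ) (η : H) (n : ℕ) : IsProbabilityMeasure (m.lawN θ η n) := by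
  have := fun i => m.isProbabilityMeasure_law hθ η i
  unfold lawN
  infer_instance

/-- Only an inequality: the law at `η` may charge the zero set of the density at `η₀`. -/
lemma lintegral_ratio_le_one (m : IndepModel k H 𝒳) {θ₀ : EuclideanSpace ℝ (Fin k)}
    (hθ₀ : θ₀ ∈ m.Θ) (η₀ η : H) (i : ℕ) :
    ∫⁻ x, m.ratio θ₀ η₀ i η x ∂(m.law θ₀ η₀ i) ≤ 1 := by
  rw [← m.lintegral_p θ₀ hθ₀ η i]
  refine (lintegral_withDensity_le_lintegral_mul _
    (m.measurable_p_right hθ₀ η₀ i).ennreal_ofReal _).trans (lintegral_mono fun x => ?_)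
  exact ENNReal.mul_div_le

/-- The expected mixture of likelihood ratios is at most one. -/
lemma lintegral_lintegral_ratioN_le (m : IndepModel k H 𝒳) {θ₀ : EuclideanSpace ℝ (Fin k)}
    (hθ₀ : θ₀ ∈ m.Θ) (η₀ : H) (prior : Measure H) [IsProbabilityMeasure prior] (n : ℕ) :
    ∫⁻ x, ∫⁻ η, m.ratioN θ₀ η₀ n η x ∂prior ∂(m.lawN θ₀ η₀ n) ≤ 1 := by
  have := fun i => m.isProbabilityMeasure_law hθ₀ η₀ i
  have h := lintegral_pi_rpow_mixture_prod_le prior 1 1 n (fun i : Fin n => m.law θ₀ η₀ i)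
    (fun i => m.ratio θ₀ η₀ i) (fun i => m.measurable_ratio hθ₀ η₀ i) (fun i ν _ _ => by
      simp only [ENNReal.rpow_one, one_mul]
      rw [lintegral_lintegral_swap (f := fun x η => m.ratio θ₀ η₀ i η x)
        ((m.measurable_ratio hθ₀ η₀ i).comp measurable_swap).aemeasurable]
      refine (lintegral_mono fun η => m.lintegral_ratio_le_one hθ₀ η₀ η i).trans ?_
      simp) prior Measure.AbsolutelyContinuous.rfl
  simpa [ratioN, lawN] using h

/-! ### Numerator: exponentially small mixtures over balls -/

/-- Each small Hellinger ball of nuisance parameters away from `η₀` has an exponentially small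
mixture of likelihood ratios. -/
lemma exists_measure_lintegral_ratioN_ball_le (m : IndepModel k H 𝒳)
    {θ₀ : EuclideanSpace ℝ (Fin k)} (hθ₀ : θ₀ ∈ m.Θ) (η₀ : H) (prior : Measure H)
    [IsProbabilityMeasure prior] (hd : m.HellingerIndexFree θ₀) {ε : ℝ} (hε : 0 < ε) :
    ∃ lam : ℝ, 0 < lam ∧ ∀ (c : H) (n : ℕ),
      m.lawN θ₀ η₀ n {x | ENNReal.ofReal (Real.exp (-(2 * lam * n))) ≤
        ∫⁻ η in {η | m.dH θ₀ c η < ε / 4} ∩ {η | ε < m.dH θ₀ η η₀}, m.ratioN θ₀ η₀ n η x ∂prior}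
      ≤ ENNReal.ofReal (Real.exp (-(lam * n))) := by
  have := fun i => m.isProbabilityMeasure_law hθ₀ η₀ i
  have := m.sigmaFinite_μ
  -- `a = (ε/4)²` is the squared ball radius; `b = ε²/2 - a` is what the squared triangle inequality
  -- leaves between the centre and `η₀`. Then `b/2 - a = 5ε²/32 > 0`, and the floor `1/2` keeps `log
  -- ρ` meaningful.
  set a : ℝ := ε ^ 2 / 16 with ha
  set b : ℝ := 7 * ε ^ 2 / 16 with hb
  set ρ : ℝ := max (1 / 2) (1 - (b / 2 - a) / 2) with hρ
  have hρ0 : 0 < ρ := lt_max_of_lt_left (by norm_num)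
  have hρ1 : ρ < 1 := max_lt (by norm_num) (by rw [ha, hb]; nlinarith [sq_pos_of_pos hε])
  refine ⟨-Real.log ρ / 2, by linarith [Real.log_neg hρ0 hρ1], fun c n => ?_⟩
  set lam : ℝ := -Real.log ρ / 2 with hlam
  have hdi : ∀ (i : ℕ) (η₁ η₂ : H), ENNReal.ofReal (m.dH θ₀ η₁ η₂ ^ 2)
      = hellingerSq (m.μ i) (m.p θ₀ η₁ i) (m.p θ₀ η₂ i) := fun i η₁ η₂ => by
    rw [dH, hd 0 i, m.ofReal_hellinger_sq hθ₀]
  have hd0 : ∀ η₁ η₂ : H, 0 ≤ m.dH θ₀ η₁ η₂ := fun _ _ => Real.sqrt_nonneg _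
  set B := {η | m.dH θ₀ c η < ε / 4} ∩ {η | ε < m.dH θ₀ η η₀} with hB
  -- A point of `B` is needed to see that the centre `c` is far from `η₀`; an empty `B` contributes
  -- nothing.
  rcases B.eq_empty_or_nonempty with hBe | ⟨η₁, hη₁c, hη₁⟩
  · rw [hBe]
    simp [not_le.2 (Real.exp_pos _)]
  have hfar : ∀ i, ENNReal.ofReal b ≤ hellingerSq (m.μ i) (m.p θ₀ η₀ i) (m.p θ₀ c i) := by
    intro i
    have h1 := hellingerSq_le_two_mul_add (m.μ i) (r := m.p θ₀ η₀ i)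
      (m.measurable_p_right hθ₀ η₁ i) (m.measurable_p_right hθ₀ c i)
    rw [hellingerSq_comm _ (m.p θ₀ η₁ i) (m.p θ₀ c i), ← hdi, ← hdi, ← hdi,
      ← ENNReal.ofReal_ofNat, ← ENNReal.ofReal_mul (by norm_num),
      ← ENNReal.ofReal_mul (by norm_num), ← ENNReal.ofReal_add (by positivity) (by positivity),
      ENNReal.ofReal_le_ofReal_iff (by positivity)] at h1
    rw [hellingerSq_comm, ← hdi]
    refine ENNReal.ofReal_le_ofReal ?_
    have h2 : m.dH θ₀ c η₁ ^ 2 ≤ (ε / 4) ^ 2 := pow_le_pow_left₀ (hd0 _ _) hη₁c.le 2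
    have h3 : ε ^ 2 ≤ m.dH θ₀ η₁ η₀ ^ 2 := pow_le_pow_left₀ hε.le hη₁.le 2
    rw [hb]
    nlinarith
  -- A measurable superset of `B`, so closeness holds almost everywhere on `B` without measurability
  -- of `B` itself.
  have hcloseM : MeasurableSet {η | hellingerSq (m.μ 0) (m.p θ₀ c 0) (m.p θ₀ η 0)
      ≤ ENNReal.ofReal a} := by
    refine measurableSet_le ?_ measurable_const
    have h1 := m.measurable_p_right hθ₀ c 0
    have h2 := m.measurable_p θ₀ hθ₀ 0
    exact Measurable.lintegral_prod_right' (f := fun z : H × 𝒳 0 =>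
      ENNReal.ofReal ((√(m.p θ₀ c 0 z.2) - √(m.p θ₀ z.1 0 z.2)) ^ 2)) (by fun_prop)
  have hclose0 : ∀ᵐ η ∂(prior.restrict B),
      hellingerSq (m.μ 0) (m.p θ₀ c 0) (m.p θ₀ η 0) ≤ ENNReal.ofReal a := by
    have : B ⊆ {η | hellingerSq (m.μ 0) (m.p θ₀ c 0) (m.p θ₀ η 0) ≤ ENNReal.ofReal a} := by
      intro η hη
      rw [Set.mem_ofPred_eq, ← hdi]
      refine ENNReal.ofReal_le_ofReal ?_
      have h2 : m.dH θ₀ c η ^ 2 ≤ (ε / 4) ^ 2 := pow_le_pow_left₀ (hd0 _ _) hη.1.le 2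
      rw [ha]
      linarith
    exact ae_restrict_of_ae_restrict_of_subset this (ae_restrict_mem hcloseM)
  have key := lintegral_pi_rpow_mixture_prod_le (prior.restrict B) (1 / 2) (ENNReal.ofReal ρ) n
    (fun i : Fin n => m.law θ₀ η₀ i) (fun i => m.ratio θ₀ η₀ i)
    (fun i => m.measurable_ratio hθ₀ η₀ i) (fun i ν _ hν => by
      refine lintegral_sqrt_mixture_ratio_le (m.μ i) ν (m.measurable_p_right hθ₀ η₀ i)
        (r := fun η => m.p θ₀ η i) (m.measurable_p_right hθ₀ c i) (m.measurable_p θ₀ hθ₀ i)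
        (m.p_nonneg θ₀ hθ₀ η₀ i)
        (m.p_nonneg θ₀ hθ₀ c i) (fun η => m.p_nonneg θ₀ hθ₀ η i) (m.lintegral_p θ₀ hθ₀ η₀ i)
        (fun η => m.lintegral_p θ₀ hθ₀ η i) (a := a) (b := b) (by positivity) ?_ (hfar i)
        (le_max_right _ _) hρ0
      -- Closeness in coordinate 0 is closeness in coordinate `i`, since `d_H` is index-free.
      filter_upwards [hν.ae_le hclose0] with η hη
      rwa [← hdi i, hdi 0]) (prior.restrict B) Measure.AbsolutelyContinuous.rfl
  set F : ((i : Fin n) → 𝒳 i) → ENNReal :=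
    fun x => ∫⁻ η in B, m.ratioN θ₀ η₀ n η x ∂prior with hF
  have hFm : Measurable F := Measurable.lintegral_prod_left' (m.measurable_ratioN hθ₀ η₀ n)
  have hE : ∫⁻ x, F x ^ (1 / 2 : ℝ) ∂(m.lawN θ₀ η₀ n)
      ≤ ENNReal.ofReal (Real.exp (-(2 * lam * n))) := by
    refine (key.trans (mul_le_of_le_one_right' ?_)).trans (le_of_eq ?_)
    · refine ENNReal.rpow_le_one ?_ (by norm_num)
      rw [Measure.restrict_apply_univ]
      exact prob_le_one
    · rw [← ENNReal.ofReal_pow hρ0.le]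
      congr 1
      rw [hlam, show -(2 * (-Real.log ρ / 2) * n) = n * Real.log ρ by ring, Real.exp_nat_mul,
        Real.exp_log hρ0]
  have hsqrt : ∀ x, ENNReal.ofReal (Real.exp (-(2 * lam * n))) ≤ F x →
      ENNReal.ofReal (Real.exp (-(lam * n))) ≤ F x ^ (1 / 2 : ℝ) := fun x hx => by
    refine le_trans (le_of_eq ?_) (ENNReal.rpow_le_rpow hx (by norm_num))
    rw [ENNReal.ofReal_rpow_of_nonneg (Real.exp_pos _).le (by norm_num), ← Real.exp_mul]
    congr 2
    ring
  refine (measure_mono hsqrt).trans ?_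
  -- Markov for `√F`: its mean is at most `ρ ^ n = exp (-2 lam n)` and the level is `exp (-lam n)`.
  have hM := (mul_meas_ge_le_lintegral (hFm.pow_const (1 / 2 : ℝ)) (μ := m.lawN θ₀ η₀ n)
    (ENNReal.ofReal (Real.exp (-(lam * n))))).trans hE
  have he : ENNReal.ofReal (Real.exp (-(2 * lam * n)))
      = ENNReal.ofReal (Real.exp (-(lam * n))) * ENNReal.ofReal (Real.exp (-(lam * n))) := by
    rw [← ENNReal.ofReal_mul (Real.exp_pos _).le, ← Real.exp_add]
    congr 2
    ring
  rw [he] at hM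
  exact (ENNReal.mul_le_mul_iff_right (by simp [Real.exp_pos]) ENNReal.ofReal_ne_top).1 hM

/-- Almost sure properties of the observations hold simultaneously. -/
lemma ae_lawN_of_forall (m : IndepModel k H 𝒳) {θ : EuclideanSpace ℝ (Fin k)} (hθ : θ ∈ m.Θ)
    (η : H) {q : (i : ℕ) → 𝒳 i → Prop} (hq : ∀ i, ∀ᵐ x ∂(m.law θ η i), q i x) (n : ℕ) :
    ∀ᵐ x ∂(m.lawN θ η n), ∀ i : Fin n, q i (x i) := by
  have := fun i => m.isProbabilityMeasure_law hθ η i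
  exact eventually_all.2 fun i => (Measure.tendsto_eval_ae_ae
    (μ := fun i : Fin n => m.law θ η i) (i := i)).eventually (hq i)

lemma ae_lawN_pos (m : IndepModel k H 𝒳) {θ : EuclideanSpace ℝ (Fin k)}
    (hθ : θ ∈ m.Θ) (η : H) (n : ℕ) : ∀ᵐ x ∂(m.lawN θ η n), ∀ i : Fin n, 0 < m.p θ η i (x i) :=
  m.ae_lawN_of_forall hθ η (m.ae_law_pos hθ η) n

/-! ### Denominator: Kullback–Leibler lower bound -/

/-- For `η` in the Kullback–Leibler neighbourhood the likelihood ratio is rarely very small. -/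
lemma measure_ratioN_lt_le (m : IndepModel k H 𝒳) {θ₀ : EuclideanSpace ℝ (Fin k)}
    (hθ₀ : θ₀ ∈ m.Θ) (η₀ : H) {δ : ℝ} (hδ : 0 < δ) {η : H} (hη : η ∈ m.KLNhd θ₀ η₀ δ) {n : ℕ}
    (hn : 0 < n) :
    m.lawN θ₀ η₀ n {x | m.ratioN θ₀ η₀ n η x < ENNReal.ofReal (Real.exp (-(2 * n * δ ^ 2)))}
      ≤ ENNReal.ofReal (1 / (n * δ ^ 2)) := by
  have := fun i => m.isProbabilityMeasure_law hθ₀ η₀ i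
  set Y : (i : ℕ) → 𝒳 i → ℝ := fun i x => Real.log (m.p θ₀ η i x / m.p θ₀ η₀ i x) with hY
  have hL2 : ∀ i, MemLp (Y i) 2 (m.law θ₀ η₀ i) := fun i => (hη i).2.1
  set S : ((i : Fin n) → 𝒳 i) → ℝ := fun x => ∑ i : Fin n, Y i (x i) with hS
  have hSeq : S = ∑ i : Fin n, fun x : (i : Fin n) → 𝒳 i => Y i (x i) := by
    ext x
    simp [hS]
  have hmem : ∀ i : Fin n, MemLp (fun x : (i : Fin n) → 𝒳 i => Y i (x i)) 2 (m.lawN θ₀ η₀ n) :=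
    fun i => (hL2 i).comp_measurePreserving
      (measurePreserving_eval (fun i : Fin n => m.law θ₀ η₀ i) i)
  have hSmem : MemLp S 2 (m.lawN θ₀ η₀ n) := by
    rw [hSeq]
    exact memLp_finsetSum' _ fun i _ => hmem i
  have hprob := m.isProbabilityMeasure_lawN hθ₀ η₀ n
  have hmean : -(n * δ ^ 2) ≤ ∫ x, S x ∂(m.lawN θ₀ η₀ n) := by
    rw [hS, integral_finsetSum _ fun i _ => (hmem i).integrable (by norm_num)]
    have : ∀ i : Fin n, -δ ^ 2 ≤ ∫ x, Y i (x i) ∂(m.lawN θ₀ η₀ n) := fun i => by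
      rw [lawN, integral_comp_eval (μ := fun i : Fin n => m.law θ₀ η₀ i) (f := Y i) (hL2 i).1]
      have := (hη i).2.2.1
      rw [integral_neg] at this
      linarith
    calc -(n * δ ^ 2) = ∑ i : Fin n, -δ ^ 2 := by simp
      _ ≤ _ := Finset.sum_le_sum fun i _ => this i
  have hvar : ProbabilityTheory.variance S (m.lawN θ₀ η₀ n) ≤ n * δ ^ 2 := by
    rw [hSeq, lawN, ProbabilityTheory.variance_sum_pi fun i : Fin n => hL2 i]
    calc _ ≤ ∑ i : Fin n, δ ^ 2 := Finset.sum_le_sum fun i _ =>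
          (ProbabilityTheory.variance_le_expectation_sq (hL2 i).1).trans (hη i).2.2.2
      _ = n * δ ^ 2 := by simp
  have hn' : (0 : ℝ) < n := by exact_mod_cast hn
  have hc : 0 < n * δ ^ 2 := by positivity
  -- The log ratio has mean at least `-nδ²` and variance at most `nδ²`, so falling below `-2nδ²` is
  -- a deviation of at least `nδ²`.
  have hcheb := ProbabilityTheory.meas_ge_le_variance_div_sq hSmem hc
  refine le_trans (measure_mono_ae ?_) (hcheb.trans (ENNReal.ofReal_le_ofReal ?_))
  · have hpos : ∀ᵐ x ∂(m.lawN θ₀ η₀ n), ∀ i : Fin n,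
        0 < m.p θ₀ η i (x i) ∧ 0 < m.p θ₀ η₀ i (x i) :=
      m.ae_lawN_of_forall hθ₀ η₀ (q := fun i y => 0 < m.p θ₀ η i y ∧ 0 < m.p θ₀ η₀ i y)
        (fun i => ((hη i).1).and (m.ae_law_pos hθ₀ η₀ i)) n
    filter_upwards [hpos] with x hx hlt
    have hR : m.ratioN θ₀ η₀ n η x = ENNReal.ofReal (Real.exp (S x)) := by
      rw [hS, Real.exp_sum, ENNReal.ofReal_prod_of_nonneg fun i _ => (Real.exp_pos _).le]
      refine Finset.prod_congr rfl fun i _ => ?_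
      rw [ratio, ← ENNReal.ofReal_div_of_pos (hx i).2, Real.exp_log (div_pos (hx i).1 (hx i).2)]
    have hlt' : m.ratioN θ₀ η₀ n η x < ENNReal.ofReal (Real.exp (-(2 * n * δ ^ 2))) := hlt
    rw [hR, ENNReal.ofReal_lt_ofReal_iff (Real.exp_pos _), Real.exp_lt_exp] at hlt'
    change n * δ ^ 2 ≤ |S x - ∫ x, S x ∂(m.lawN θ₀ η₀ n)|
    refine le_trans ?_ (neg_le_abs _)
    linarith
  · rw [div_le_div_iff₀ (by positivity) hc]
    nlinarith

/-- The likelihood at `θ₀` is the likelihood at `(θ₀, η₀)` times the likelihood ratio. -/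
lemma likelihood_eq_mul_ratioN (m : IndepModel k H 𝒳) {θ₀ : EuclideanSpace ℝ (Fin k)}
    {η₀ : H} {n : ℕ} {x : (i : Fin n) → 𝒳 i} (hx : ∀ i : Fin n, 0 < m.p θ₀ η₀ i (x i)) (η : H) :
    m.likelihood θ₀ η x = m.likelihood θ₀ η₀ x * m.ratioN θ₀ η₀ n η x := by
  unfold likelihood ratioN
  rw [← Finset.prod_mul_distrib]
  refine Finset.prod_congr rfl fun i _ => ?_
  exact (ENNReal.mul_div_cancel (by simpa using hx i) ENNReal.ofReal_ne_top).symm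

lemma likelihood_ne_top (m : IndepModel k H 𝒳) (θ : EuclideanSpace ℝ (Fin k)) (η : H) {n : ℕ}
    (x : (i : Fin n) → 𝒳 i) : m.likelihood θ η x ≠ ⊤ :=
  ENNReal.prod_ne_top fun _ _ => ENNReal.ofReal_ne_top

/-- The mixture of likelihood ratios is almost surely positive and finite. -/
lemma ae_lintegral_ratioN_mem_Ioo (m : IndepModel k H 𝒳) {θ₀ : EuclideanSpace ℝ (Fin k)}
    (hθ₀ : θ₀ ∈ m.Θ) (η₀ : H) (prior : Measure H) [IsProbabilityMeasure prior]
    {δ : ℝ} (hK : 0 < prior (m.KLNhd θ₀ η₀ δ)) (n : ℕ) :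
    ∀ᵐ x ∂(m.lawN θ₀ η₀ n), 0 < ∫⁻ η, m.ratioN θ₀ η₀ n η x ∂prior ∧
      ∫⁻ η, m.ratioN θ₀ η₀ n η x ∂prior < ⊤ := by
  have := fun i => m.isProbabilityMeasure_law hθ₀ η₀ i
  have hprob := m.isProbabilityMeasure_lawN hθ₀ η₀ n
  have hmeas := m.measurable_ratioN hθ₀ η₀ n
  refine (ae_lintegral_pos _ prior hmeas hK fun η hη => ?_).and
    (ae_lt_top (Measurable.lintegral_prod_left' hmeas)
      (ne_top_of_le_ne_top (by simp) (m.lintegral_lintegral_ratioN_le hθ₀ η₀ prior n)))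
  have hpos : ∀ᵐ x ∂(m.lawN θ₀ η₀ n), ∀ i : Fin n, 0 < m.p θ₀ η i (x i) :=
    m.ae_lawN_of_forall hθ₀ η₀ (fun i => (hη i).1) n
  filter_upwards [hpos] with x hx
  exact CanonicallyOrderedAdd.prod_pos.2 fun i _ =>
    ENNReal.div_pos (by simpa using hx i) ENNReal.ofReal_ne_top

/-! ### Transfer from `θ₀` to nearby `θ` -/

/-- Lipschitz log likelihoods: comparison of the likelihoods at two parameters. -/
lemma likelihood_le_exp_mul (m : IndepModel k H 𝒳) {θ₁ θ₂ : EuclideanSpace ℝ (Fin k)}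
    (hθ₁ : θ₁ ∈ m.Θ) (hθ₂ : θ₂ ∈ m.Θ) {Q : (i : ℕ) → 𝒳 i → ℝ}
    (hQ : ∀ (i : ℕ) (x : 𝒳 i) (η : H), (m.p θ₁ η i x = 0 ↔ m.p θ₂ η i x = 0) ∧
      |Real.log (m.p θ₁ η i x) - Real.log (m.p θ₂ η i x)| ≤ ‖θ₁ - θ₂‖ * Q i x)
    {n : ℕ} (x : (i : Fin n) → 𝒳 i) (η : H) :
    m.likelihood θ₁ η x ≤ ENNReal.ofReal (Real.exp (‖θ₁ - θ₂‖ * ∑ i : Fin n, |Q i (x i)|)) *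
      m.likelihood θ₂ η x := by
  unfold likelihood
  rw [Finset.mul_sum, Real.exp_sum, ENNReal.ofReal_prod_of_nonneg fun i _ => (Real.exp_pos _).le,
    ← Finset.prod_mul_distrib]
  refine Finset.prod_le_prod' fun i _ => ?_
  rw [← ENNReal.ofReal_mul (Real.exp_pos _).le]
  refine ENNReal.ofReal_le_ofReal ?_
  obtain ⟨h0, hlog⟩ := hQ i (x i) η
  rcases (m.p_nonneg θ₁ hθ₁ η i (x i)).eq_or_lt with h1 | h1
  · rw [← h1]
    exact mul_nonneg (Real.exp_pos _).le (m.p_nonneg θ₂ hθ₂ η i (x i))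
  -- The clause on zeros is essential: `Real.log 0 = 0` would make the Lipschitz bound say nothing
  -- about a vanishing density.
  have h2 : 0 < m.p θ₂ η i (x i) :=
    (m.p_nonneg θ₂ hθ₂ η i (x i)).lt_of_ne fun h => h1.ne' (h0.2 h.symm)
  rw [← Real.log_le_log_iff h1 (by positivity), Real.log_mul (Real.exp_pos _).ne' h2.ne',
    Real.log_exp]
  have h3 : ‖θ₁ - θ₂‖ * Q i (x i) ≤ ‖θ₁ - θ₂‖ * |Q i (x i)| :=
    mul_le_mul_of_nonneg_left (le_abs_self _) (norm_nonneg _)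
  linarith [le_abs_self (Real.log (m.p θ₁ η i (x i)) - Real.log (m.p θ₂ η i (x i)))]

lemma setLIntegral_likelihood_le (m : IndepModel k H 𝒳) {θ₁ θ₂ : EuclideanSpace ℝ (Fin k)}
    (hθ₁ : θ₁ ∈ m.Θ) (hθ₂ : θ₂ ∈ m.Θ) {Q : (i : ℕ) → 𝒳 i → ℝ}
    (hQ : ∀ (i : ℕ) (x : 𝒳 i) (η : H), (m.p θ₁ η i x = 0 ↔ m.p θ₂ η i x = 0) ∧
      |Real.log (m.p θ₁ η i x) - Real.log (m.p θ₂ η i x)| ≤ ‖θ₁ - θ₂‖ * Q i x)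
    {n : ℕ} (x : (i : Fin n) → 𝒳 i) (π : Measure H) :
    ∫⁻ η, m.likelihood θ₁ η x ∂π ≤
      ENNReal.ofReal (Real.exp (‖θ₁ - θ₂‖ * ∑ i : Fin n, |Q i (x i)|)) *
        ∫⁻ η, m.likelihood θ₂ η x ∂π := by
  rw [← lintegral_const_mul' _ _ ENNReal.ofReal_ne_top]
  exact lintegral_mono fun η => m.likelihood_le_exp_mul hθ₁ hθ₂ hQ x η

/-- Markov's inequality for the sum of the Lipschitz constants. -/
lemma measure_sum_abs_ge_le (m : IndepModel k H 𝒳) {θ₀ : EuclideanSpace ℝ (Fin k)}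
    (hθ₀ : θ₀ ∈ m.Θ) (η₀ : H) {Q : (i : ℕ) → 𝒳 i → ℝ} (hQm : ∀ i, Measurable (Q i))
    {C : ENNReal} (hQ2 : ∀ i, ∫⁻ x, ENNReal.ofReal (Q i x ^ 2) ∂(m.law θ₀ η₀ i) ≤ C)
    (n : ℕ) {t : ℝ} (ht : 0 < t) :
    m.lawN θ₀ η₀ n {x | t ≤ ∑ i : Fin n, |Q i (x i)|} ≤ n * (1 + C) / ENNReal.ofReal t := by
  have := fun i => m.isProbabilityMeasure_law hθ₀ η₀ i
  have hm : ∀ i : Fin n, Measurable fun x : (i : Fin n) → 𝒳 i => ENNReal.ofReal |Q i (x i)| :=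
    fun i => ((hQm i).comp (measurable_pi_apply i)).abs.ennreal_ofReal
  have hE : ∫⁻ x, ∑ i : Fin n, ENNReal.ofReal |Q i (x i)| ∂(m.lawN θ₀ η₀ n) ≤ n * (1 + C) := by
    rw [lintegral_finsetSum _ fun i _ => hm i]
    have : ∀ i : Fin n, ∫⁻ x, ENNReal.ofReal |Q i (x i)| ∂(m.lawN θ₀ η₀ n) ≤ 1 + C := fun i => by
      have h1 := (measurePreserving_eval (fun i : Fin n => m.law θ₀ η₀ i) i).lintegral_comp
        (f := fun y => ENNReal.ofReal |Q i y|) (hQm i).abs.ennreal_ofReal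
      refine (le_of_eq h1).trans ?_
      -- `|Q| ≤ 1 + Q²`, so second moments suffice for a uniform first moment bound.
      calc ∫⁻ y, ENNReal.ofReal |Q i y| ∂(m.law θ₀ η₀ i)
          ≤ ∫⁻ y, 1 + ENNReal.ofReal (Q i y ^ 2) ∂(m.law θ₀ η₀ i) := by
            refine lintegral_mono fun y => ?_
            rw [← ENNReal.ofReal_one, ← ENNReal.ofReal_add zero_le_one (sq_nonneg _)]
            refine ENNReal.ofReal_le_ofReal ?_
            nlinarith [sq_abs (Q i y), sq_nonneg (|Q i y| - 1), abs_nonneg (Q i y)]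
        _ = 1 + ∫⁻ y, ENNReal.ofReal (Q i y ^ 2) ∂(m.law θ₀ η₀ i) := by
            rw [lintegral_add_left measurable_const]
            simp
        _ ≤ 1 + C := by
            gcongr
            exact hQ2 i
    calc _ ≤ ∑ i : Fin n, (1 + C) := Finset.sum_le_sum fun i _ => this i
      _ = n * (1 + C) := by simp [mul_add]
  refine le_trans (measure_mono fun x hx => ?_)
    ((meas_ge_le_lintegral_div (μ := m.lawN θ₀ η₀ n)
      (Finset.measurable_sum Finset.univ fun i _ => hm i).aemeasurable
      (ε := ENNReal.ofReal t) (by simpa using ht) ENNReal.ofReal_ne_top).trans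
      (ENNReal.div_le_div_right hE _))
  have hx' : t ≤ ∑ i : Fin n, |Q i (x i)| := hx
  change ENNReal.ofReal t ≤ ∑ i : Fin n, ENNReal.ofReal |Q i (x i)|
  rw [← ENNReal.ofReal_sum_of_nonneg fun i _ => abs_nonneg _]
  exact ENNReal.ofReal_le_ofReal hx'

lemma setLIntegral_likelihood_eq_mul (m : IndepModel k H 𝒳) {θ₀ : EuclideanSpace ℝ (Fin k)}
    {η₀ : H} {n : ℕ} {x : (i : Fin n) → 𝒳 i} (hx : ∀ i : Fin n, 0 < m.p θ₀ η₀ i (x i))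
    (π : Measure H) :
    ∫⁻ η, m.likelihood θ₀ η x ∂π = m.likelihood θ₀ η₀ x * ∫⁻ η, m.ratioN θ₀ η₀ n η x ∂π := by
  rw [← lintegral_const_mul' _ _ (m.likelihood_ne_top _ _ _)]
  exact lintegral_congr fun η => m.likelihood_eq_mul_ratioN hx η

/-- A bound for the conditional posterior at `θ` through likelihood ratios at `θ₀`. -/
lemma condPosterior_le (m : IndepModel k H 𝒳) {θ₀ θ : EuclideanSpace ℝ (Fin k)}
    (hθ₀ : θ₀ ∈ m.Θ) (hθ : θ ∈ m.Θ) (η₀ : H) (prior : Measure H) {Q : (i : ℕ) → 𝒳 i → ℝ}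
    (hQ : ∀ (i : ℕ) (x : 𝒳 i) (η : H), (m.p θ η i x = 0 ↔ m.p θ₀ η i x = 0) ∧
      |Real.log (m.p θ η i x) - Real.log (m.p θ₀ η i x)| ≤ ‖θ - θ₀‖ * Q i x)
    (hQ' : ∀ (i : ℕ) (x : 𝒳 i) (η : H), (m.p θ₀ η i x = 0 ↔ m.p θ η i x = 0) ∧
      |Real.log (m.p θ₀ η i x) - Real.log (m.p θ η i x)| ≤ ‖θ₀ - θ‖ * Q i x)
    {n : ℕ} {x : (i : Fin n) → 𝒳 i} (hx : ∀ i : Fin n, 0 < m.p θ₀ η₀ i (x i)) {A : Set H}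
    {e a b : ℝ} (he : ‖θ - θ₀‖ * ∑ i : Fin n, |Q i (x i)| ≤ e) (ha : 0 ≤ a) (hb : 0 < b)
    (hA : ∫⁻ η in A, m.ratioN θ₀ η₀ n η x ∂prior ≤ ENNReal.ofReal a)
    (hB : ENNReal.ofReal b ≤ ∫⁻ η, m.ratioN θ₀ η₀ n η x ∂prior) :
    m.condPosterior prior θ x A ≤ ENNReal.ofReal (Real.exp (2 * e) * a / b) := by
  have hexp : ENNReal.ofReal (Real.exp (‖θ - θ₀‖ * ∑ i : Fin n, |Q i (x i)|))
      ≤ ENNReal.ofReal (Real.exp e) := ENNReal.ofReal_le_ofReal (Real.exp_le_exp.2 he)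
  have h1 := m.setLIntegral_likelihood_le hθ hθ₀ hQ x (prior.restrict A)
  have h2 := m.setLIntegral_likelihood_le hθ₀ hθ hQ' x prior
  rw [m.setLIntegral_likelihood_eq_mul hx] at h1 h2
  rw [norm_sub_rev] at h2
  set L := m.likelihood θ₀ η₀ x
  refine ENNReal.div_le_of_le_mul ?_
  change _ ≤ _ * ∫⁻ η, m.likelihood θ η x ∂prior
  have hre : Real.exp e * a = Real.exp e * a / b * b := by field_simp
  -- The factor `exp e` is paid once in the numerator and once in the denominator, hence `2 * e`.
  calc ∫⁻ η in A, m.likelihood θ η x ∂prior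
      ≤ ENNReal.ofReal (Real.exp e) * (L * ENNReal.ofReal a) := by
        refine h1.trans ?_
        gcongr
    _ = ENNReal.ofReal (Real.exp e * a / b) * (L * ENNReal.ofReal b) := by
        rw [mul_left_comm, ← ENNReal.ofReal_mul (Real.exp_pos _).le, hre,
          ENNReal.ofReal_mul (by positivity), ← hre]
        ring
    _ ≤ ENNReal.ofReal (Real.exp e * a / b) *
          (ENNReal.ofReal (Real.exp e) * ∫⁻ η, m.likelihood θ η x ∂prior) := by
        have h3 : L * ENNReal.ofReal b ≤ L * ∫⁻ η, m.ratioN θ₀ η₀ n η x ∂prior := by gcongr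
        exact mul_le_mul' le_rfl (h3.trans (h2.trans (mul_le_mul' hexp le_rfl)))
    _ = _ := by
        rw [← mul_assoc, ← ENNReal.ofReal_mul (by positivity)]
        congr 2
        rw [two_mul, Real.exp_add]
        ring

/-- The integrated likelihood at a parameter near `θ₀` is positive and finite when the mixture of
likelihood ratios is. -/
lemma integratedLikelihood_mem_Ioo (m : IndepModel k H 𝒳) {θ₀ θ : EuclideanSpace ℝ (Fin k)}
    (hθ₀ : θ₀ ∈ m.Θ) (hθ : θ ∈ m.Θ) (η₀ : H) (prior : Measure H) {Q : (i : ℕ) → 𝒳 i → ℝ}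
    (hQ : ∀ (i : ℕ) (x : 𝒳 i) (η : H), (m.p θ η i x = 0 ↔ m.p θ₀ η i x = 0) ∧
      |Real.log (m.p θ η i x) - Real.log (m.p θ₀ η i x)| ≤ ‖θ - θ₀‖ * Q i x)
    (hQ' : ∀ (i : ℕ) (x : 𝒳 i) (η : H), (m.p θ₀ η i x = 0 ↔ m.p θ η i x = 0) ∧
      |Real.log (m.p θ₀ η i x) - Real.log (m.p θ η i x)| ≤ ‖θ₀ - θ‖ * Q i x)
    {n : ℕ} {x : (i : Fin n) → 𝒳 i} (hx : ∀ i : Fin n, 0 < m.p θ₀ η₀ i (x i))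
    (h0 : 0 < ∫⁻ η, m.ratioN θ₀ η₀ n η x ∂prior)
    (htop : ∫⁻ η, m.ratioN θ₀ η₀ n η x ∂prior < ⊤) :
    0 < m.integratedLikelihood prior θ x ∧ m.integratedLikelihood prior θ x < ⊤ := by
  have h1 := m.setLIntegral_likelihood_le hθ hθ₀ hQ x prior
  have h2 := m.setLIntegral_likelihood_le hθ₀ hθ hQ' x prior
  rw [m.setLIntegral_likelihood_eq_mul hx] at h1 h2
  have hL : 0 < m.likelihood θ₀ η₀ x :=
    CanonicallyOrderedAdd.prod_pos.2 fun i _ => by simpa using hx i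
  constructor
  · have h3 := (ENNReal.mul_pos hL.ne' h0.ne').trans_le h2
    exact pos_iff_ne_zero.2 fun h => by
      rw [show ∫⁻ η, m.likelihood θ η x ∂prior = 0 from h] at h3
      simp at h3
  · exact h1.trans_lt (ENNReal.mul_lt_top ENNReal.ofReal_lt_top
      (ENNReal.mul_lt_top (m.likelihood_ne_top _ _ _).lt_top htop))

/-! ### Combination of the bounds -/

/-- Under a finite Hellinger cover and prior mass near `η₀`, outside an event of vanishing
probability the nuisance parameters away from `η₀` have exponentially small relative weight. -/
lemma exists_lintegral_ratioN_bounds (m : IndepModel k H 𝒳) {θ₀ : EuclideanSpace ℝ (Fin k)}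
    (hθ₀ : θ₀ ∈ m.Θ) (η₀ : H) (prior : Measure H) [IsProbabilityMeasure prior]
    (hd : m.HellingerIndexFree θ₀) (hN : ∀ δ : ℝ, 0 < δ → coveringNumberOf (m.dH θ₀) δ < ⊤)
    (hK : ∀ δ : ℝ, 0 < δ → 0 < prior (m.KLNhd θ₀ η₀ δ)) {ε : ℝ} (hε : 0 < ε) :
    ∃ lam > 0, ∃ κ > 0, ∃ s : ℕ, ∀ n : ℕ, 0 < n → ∃ G : Set ((i : Fin n) → 𝒳 i),
      m.lawN θ₀ η₀ n Gᶜ ≤ ENNReal.ofReal (2 * (1 / (n * (lam / 4))) + s * Real.exp (-(lam * n))) ∧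
      ∀ x ∈ G, ∫⁻ η in {η | ε < m.dH θ₀ η η₀}, m.ratioN θ₀ η₀ n η x ∂prior
          ≤ ENNReal.ofReal (s * Real.exp (-(2 * lam * n))) ∧
        ENNReal.ofReal (Real.exp (-(lam * n / 2)) * κ) ≤
          ∫⁻ η, m.ratioN θ₀ η₀ n η x ∂prior := by
  obtain ⟨lam, hlam, hball⟩ := m.exists_measure_lintegral_ratioN_ball_le hθ₀ η₀ prior hd hε
  obtain ⟨S, hS⟩ := exists_finset_cover_of_coveringNumberOf_lt_top (hN (ε / 4) (by positivity))
  -- Chosen so that the denominator bound `exp (-2nδ²)` equals `exp (-lam n / 2)`, which dominates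
  -- the numerator's `exp (-2 lam n)` with room for the change of `θ`.
  set δ : ℝ := √lam / 2 with hδ
  have hδ0 : 0 < δ := by positivity
  have hδ2 : δ ^ 2 = lam / 4 := by
    rw [hδ, div_pow, Real.sq_sqrt hlam.le]
    norm_num
  have hKδ := hK δ hδ0
  set K := m.KLNhd θ₀ η₀ δ with hKdef
  have hKfin : prior K / 2 ≠ ⊤ := ENNReal.div_ne_top (measure_ne_top _ _) (by simp)
  have hκ : 0 < (prior K / 2).toReal :=
    ENNReal.toReal_pos (ENNReal.div_pos hKδ.ne' (by simp)).ne' hKfin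
  refine ⟨lam, hlam, (prior K / 2).toReal, hκ, S.card, fun n hn => ?_⟩
  have hprob := m.isProbabilityMeasure_lawN hθ₀ η₀ n
  set A : Set H := {η | ε < m.dH θ₀ η η₀} with hA
  set D : Set ((i : Fin n) → 𝒳 i) := {x | ∫⁻ η, m.ratioN θ₀ η₀ n η x ∂prior <
    ENNReal.ofReal (Real.exp (-(2 * n * δ ^ 2))) * (prior K / 2)} with hD
  set N : H → Set ((i : Fin n) → 𝒳 i) := fun c =>
    {x | ENNReal.ofReal (Real.exp (-(2 * lam * n))) ≤
      ∫⁻ η in {η | m.dH θ₀ c η < ε / 4} ∩ A, m.ratioN θ₀ η₀ n η x ∂prior} with hNdef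
  refine ⟨(D ∪ ⋃ c ∈ S, N c)ᶜ, ?_, fun x hx => ?_⟩
  · rw [compl_compl]
    have hDle : m.lawN θ₀ η₀ n D ≤ 2 * ENNReal.ofReal (1 / (n * δ ^ 2)) :=
      measure_lintegral_lt_le _ prior (m.measurable_ratioN hθ₀ η₀ n) hKδ
        fun η hη => m.measure_ratioN_lt_le hθ₀ η₀ hδ0 hη hn
    have hNle : m.lawN θ₀ η₀ n (⋃ c ∈ S, N c) ≤ S.card * ENNReal.ofReal (Real.exp (-(lam * n))) := by
      refine (measure_biUnion_finset_le _ _).trans ?_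
      refine (Finset.sum_le_sum fun c _ => hball c n).trans (le_of_eq ?_)
      simp
    refine (measure_union_le _ _).trans ((add_le_add hDle hNle).trans (le_of_eq ?_))
    rw [ENNReal.ofReal_add (by positivity) (by positivity), ENNReal.ofReal_mul (by norm_num),
      ENNReal.ofReal_mul (by positivity), hδ2]
    simp
  · simp only [Set.mem_compl_iff, Set.mem_union, Set.mem_iUnion, not_or, not_exists] at hx
    obtain ⟨hxD, hxN⟩ := hx
    constructor
    · have hcov : A ⊆ ⋃ c : S, {η | m.dH θ₀ c η < ε / 4} ∩ A := fun η hη => by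
        obtain ⟨c, hc, hcη⟩ := hS η
        exact Set.mem_iUnion.2 ⟨⟨c, hc⟩, hcη, hη⟩
      refine (lintegral_mono_set hcov).trans ((lintegral_iUnion_le _ _).trans ?_)
      rw [tsum_fintype]
      refine (Finset.sum_le_sum (g := fun _ => ENNReal.ofReal (Real.exp (-(2 * lam * n))))
        fun (c : S) _ => (not_le.1 (hxN c.1 c.2)).le).trans (le_of_eq ?_)
      rw [ENNReal.ofReal_mul (by positivity)]
      simp
    · refine le_trans (le_of_eq ?_) (not_lt.1 hxD)
      rw [ENNReal.ofReal_mul (Real.exp_pos _).le, ENNReal.ofReal_toReal hKfin, hδ2]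
      congr 3
      ring

end IndepModel

theorem mainTheorem9 {k : ℕ} {H : Type*} [MeasurableSpace H]
    {𝒳 : ℕ → Type*} [∀ i, MeasurableSpace (𝒳 i)]
    (m : IndepModel k H 𝒳) (θ₀ : EuclideanSpace ℝ (Fin k)) (hθ₀ : θ₀ ∈ m.Θ) (η₀ : H)
    (prior : Measure H) [IsProbabilityMeasure prior]
    (hd : m.HellingerIndexFree θ₀)
    (hLip : m.HellingerLipschitz θ₀)
    (hQ : m.LogLikLipschitz θ₀ η₀)
    (hN : ∀ δ : ℝ, 0 < δ → coveringNumberOf (m.dH θ₀) δ < ⊤)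
    (hK : ∀ δ : ℝ, 0 < δ → 0 < prior (m.KLNhd θ₀ η₀ δ))
    -- for each `n`, a probability space carrying the data `X n` of size `n` and the random `h n`
    {Ω : ℕ → Type*} [∀ n, MeasurableSpace (Ω n)]
    (P : (n : ℕ) → Measure (Ω n)) [∀ n, IsProbabilityMeasure (P n)]
    (X : (n : ℕ) → Ω n → (i : Fin n) → 𝒳 i) (hX : ∀ n, Measurable (X n))
    (hlaw : ∀ n, (P n).map (X n) = m.lawN θ₀ η₀ n)
    (h : (n : ℕ) → Ω n → EuclideanSpace ℝ (Fin k)) (hh : ∀ n, Measurable (h n))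
    (hbdd : ∃ M : ℝ, ∀ n, ∀ᵐ ω ∂(P n), ‖h n ω‖ ≤ M)
    (ε : ℝ) (hε : 0 < ε) :
    (∀ᶠ n in atTop, ∀ᵐ ω ∂(P n),
      0 < m.integratedLikelihood prior (localParam θ₀ n (h n ω)) (X n ω) ∧
      m.integratedLikelihood prior (localParam θ₀ n (h n ω)) (X n ω) < ⊤) ∧
    ∀ δ : ENNReal, 0 < δ →
      Tendsto (fun n => P n {ω | δ ≤ m.condPosterior prior (localParam θ₀ n (h n ω)) (X n ω)
        {η | ε < m.dH θ₀ η η₀}}) atTop (𝓝 0) := by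

  obtain ⟨M₀, hM₀⟩ := hbdd
  obtain ⟨U, hU, hUΘ, Q, hQm, hQ2, hQL⟩ := hQ
  -- Positivity of `M` allows division by it in the constant `c`.
  set M := max M₀ 1 with hM
  have hM0 : 0 < M := lt_max_of_lt_right one_pos
  have hbd : ∀ n, ∀ᵐ ω ∂(P n), ‖h n ω‖ ≤ M := fun n =>
    (hM₀ n).mono fun ω hω => hω.trans (le_max_left _ _)
  have hθ₀U : θ₀ ∈ U := mem_of_mem_nhds hU
  have hnorm : ∀ (n : ℕ) (v : EuclideanSpace ℝ (Fin k)), ‖v‖ ≤ M →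
      ‖localParam θ₀ n v - θ₀‖ ≤ M / √n := fun n v hv => by
    rw [localParam, add_sub_cancel_left, norm_smul, norm_inv, Real.norm_of_nonneg
      (Real.sqrt_nonneg _), inv_mul_eq_div]
    gcongr
  have hsqrt : Tendsto (fun n : ℕ => √(n : ℝ)) atTop atTop :=
    Real.tendsto_sqrt_atTop.comp tendsto_natCast_atTop_atTop
  have hev : ∀ᶠ n : ℕ in atTop, 0 < n ∧ ∀ v : EuclideanSpace ℝ (Fin k), ‖v‖ ≤ M →
      localParam θ₀ n v ∈ U := by
    obtain ⟨r, hr, hrU⟩ := Metric.mem_nhds_iff.1 hU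
    filter_upwards [eventually_gt_atTop 0,
      (hsqrt.const_div_atTop M).eventually (gt_mem_nhds hr)] with n hn0 hn
    exact ⟨hn0, fun v hv => hrU (by
      rw [mem_ball_iff_norm]
      exact (hnorm n v hv).trans_lt hn)⟩
  have hpair : ∀ θ₁ ∈ U, ∀ θ₂ ∈ U, ∀ (i : ℕ) (x : 𝒳 i) (η : H),
      (m.p θ₁ η i x = 0 ↔ m.p θ₂ η i x = 0) ∧
        |Real.log (m.p θ₁ η i x) - Real.log (m.p θ₂ η i x)| ≤ ‖θ₁ - θ₂‖ * Q i x :=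
    fun θ₁ h₁ θ₂ h₂ i => hQL i θ₁ h₁ θ₂ h₂
  refine ⟨?_, fun δ hδ => ?_⟩
  · filter_upwards [hev] with n ⟨_, hn⟩
    have hae : ∀ᵐ x ∂((P n).map (X n)), (∀ i : Fin n, 0 < m.p θ₀ η₀ i (x i)) ∧
        0 < ∫⁻ η, m.ratioN θ₀ η₀ n η x ∂prior ∧ ∫⁻ η, m.ratioN θ₀ η₀ n η x ∂prior < ⊤ := by
      rw [hlaw n]
      exact (m.ae_lawN_pos hθ₀ η₀ n).and
        (m.ae_lintegral_ratioN_mem_Ioo hθ₀ η₀ prior (hK 1 one_pos) n)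
    filter_upwards [hbd n, ae_of_ae_map (hX n).aemeasurable hae] with ω hω hx
    exact m.integratedLikelihood_mem_Ioo hθ₀ (hUΘ (hn _ hω)) η₀ prior (hpair _ (hn _ hω) _ hθ₀U)
      (hpair _ hθ₀U _ (hn _ hω)) hx.1 hx.2.1 hx.2.2
  · obtain ⟨lam, hlam, κ, hκ, s, hG⟩ :=
      m.exists_lintegral_ratioN_bounds hθ₀ η₀ prior hd hN hK hε
    set C := ⨆ i, ∫⁻ x, ENNReal.ofReal (Q i x ^ 2) ∂(m.law θ₀ η₀ i) with hC
    -- With `∑ |Q i| < c n √n` the exponent `M / √n * ∑ |Q i|` is at most `lam n / 4`; Markov makes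
    -- the complementary event `O(1/√n)`.
    set c : ℝ := lam / (4 * M) with hc
    have hc0 : 0 < c := by positivity
    set β : ℕ → ℝ := fun n => (1 + C.toReal) / (c * √n) +
      (2 * (1 / (n * (lam / 4))) + s * Real.exp (-(lam * n))) with hβ
    -- The resulting posterior bound: `exp (lam n / 2) * s exp (-2 lam n) / (κ exp (-lam n / 2))`.
    set v : ℕ → ℝ := fun n => s / κ * Real.exp (-(lam * n)) with hv
    have hexp : Tendsto (fun n : ℕ => Real.exp (-(lam * n))) atTop (𝓝 0) :=
      Real.tendsto_exp_neg_atTop_nhds_zero.comp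
        (tendsto_natCast_atTop_atTop.const_mul_atTop hlam)
    have hvlim : Tendsto v atTop (𝓝 0) := by simpa using hexp.const_mul (s / κ)
    have hβlim : Tendsto β atTop (𝓝 0) := by
      have h1 : Tendsto (fun n : ℕ => (1 + C.toReal) / (c * √n)) atTop (𝓝 0) :=
        (hsqrt.const_mul_atTop hc0).const_div_atTop _
      have h2 : Tendsto (fun n : ℕ => 1 / (n * (lam / 4))) atTop (𝓝 0) :=
        ((tendsto_natCast_atTop_atTop (R := ℝ)).atTop_mul_const (by positivity)).const_div_atTop _
      have h3 := h1.add ((h2.const_mul 2).add (hexp.const_mul (s : ℝ)))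
      simpa only [mul_zero, add_zero] using h3
    have hvE : Tendsto (fun n => ENNReal.ofReal (v n)) atTop (𝓝 0) := by
      simpa using ENNReal.tendsto_ofReal hvlim
    have hβE : Tendsto (fun n => ENNReal.ofReal (β n)) atTop (𝓝 0) := by
      simpa using ENNReal.tendsto_ofReal hβlim
    refine tendsto_of_tendsto_of_tendsto_of_le_of_le' tendsto_const_nhds hβE
      (Eventually.of_forall fun n => zero_le) ?_
    filter_upwards [hev, hvE.eventually (gt_mem_nhds hδ)] with n ⟨hn0, hn⟩ hvn
    have hn' : (0 : ℝ) < n := by exact_mod_cast hn0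
    have hsn : 0 < √(n : ℝ) := Real.sqrt_pos.2 hn'
    obtain ⟨G, hGm, hGx⟩ := hG n hn0
    set T : Set ((i : Fin n) → 𝒳 i) := {x | c * n * √n ≤ ∑ i : Fin n, |Q i (x i)|} with hT
    have hTle : m.lawN θ₀ η₀ n T ≤ ENNReal.ofReal ((1 + C.toReal) / (c * √n)) := by
      refine (m.measure_sum_abs_ge_le hθ₀ η₀ hQm (C := C) (fun i => le_iSup (fun i =>
        ∫⁻ x, ENNReal.ofReal (Q i x ^ 2) ∂(m.law θ₀ η₀ i)) i) n (by positivity)).trans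
        (le_of_eq ?_)
      rw [← ENNReal.ofReal_toReal hQ2.ne, ← ENNReal.ofReal_one,
        ← ENNReal.ofReal_add zero_le_one ENNReal.toReal_nonneg, ← ENNReal.ofReal_natCast,
        ← ENNReal.ofReal_mul hn'.le, ← ENNReal.ofReal_div_of_pos (by positivity)]
      congr 1
      rw [ENNReal.toReal_ofReal ENNReal.toReal_nonneg]
      field_simp
    have hpos := m.ae_lawN_pos hθ₀ η₀ n
    have hsub : {ω | δ ≤ m.condPosterior prior (localParam θ₀ n (h n ω)) (X n ω)
        {η | ε < m.dH θ₀ η η₀}} ⊆ X n ⁻¹' (T ∪ Gᶜ ∪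
          {x | ¬ ∀ i : Fin n, 0 < m.p θ₀ η₀ i (x i)}) ∪ {ω | ¬ ‖h n ω‖ ≤ M} := by
      intro ω hω
      by_contra hcon
      simp only [Set.mem_union, Set.mem_preimage, Set.mem_compl_iff, not_or, not_not,
        Set.mem_ofPred_eq] at hcon
      obtain ⟨⟨⟨hωT, hωG⟩, hωp⟩, hωM⟩ := hcon
      obtain ⟨hnum, hden⟩ := hGx _ hωG
      have hθU := hn _ hωM
      have he : ‖localParam θ₀ n (h n ω) - θ₀‖ * ∑ i : Fin n, |Q i (X n ω i)| ≤ lam * n / 4 := by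
        calc _ ≤ M / √n * (c * n * √n) := by
              refine mul_le_mul (hnorm n _ hωM) (not_le.1 hωT).le
                (Finset.sum_nonneg fun i _ => abs_nonneg _) (by positivity)
          _ = lam * n / 4 := by
              rw [hc]
              field_simp
      have hle := m.condPosterior_le hθ₀ (hUΘ hθU) η₀ prior (hpair _ hθU _ hθ₀U)
        (hpair _ hθ₀U _ hθU) hωp he (by positivity) (by positivity) hnum hden
      refine absurd (hω.trans hle) (not_le.2 (lt_of_eq_of_lt ?_ hvn))
      congr 1
      have e1 : Real.exp (2 * (lam * n / 4)) * Real.exp (-(2 * lam * n))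
          = Real.exp (-(lam * n)) * Real.exp (-(lam * n / 2)) := by
        rw [← Real.exp_add, ← Real.exp_add]
        congr 1
        ring
      rw [hv, div_eq_iff (by positivity), mul_left_comm, e1]
      field_simp
    refine (measure_mono hsub).trans ((measure_union_le _ _).trans ?_)
    have hM' : P n {ω | ¬ ‖h n ω‖ ≤ M} = 0 := hbd n
    rw [hM', add_zero]
    -- This inequality holds for arbitrary sets, so `G` need not be measurable.
    refine (Measure.le_map_apply (hX n).aemeasurable _).trans ?_
    rw [hlaw n]
    refine (measure_union_le _ _).trans ?_
    rw [show m.lawN θ₀ η₀ n {x | ¬ ∀ i : Fin n, 0 < m.p θ₀ η₀ i (x i)} = 0 from hpos, add_zero]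
    refine (measure_union_le _ _).trans ((add_le_add hTle hGm).trans (le_of_eq ?_))
    rw [← ENNReal.ofReal_add (by positivity) (by positivity)]

end
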